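/- Let $\mathbb F$ be a field and let $M,N$ be finitely presented persistence modules over the poset $\mathbb R^2$ (with the componentwise order) and with coefficients in $\mathbb F$. Every line $L\subset\mathbb R^2$ of positive slope is parameterized as $s\mapsto s\,\vec m+b$ with $m_1,m_2>0$, $\max\{m_1,m_2\}=1$, $b_1+b_2=0$; put $\hat m^L=\min\{m_1,m_2\}$, let $M^L,N^L$ be the one-parameter persistence modules obtained by restricting $M,N$ to $L$ with this parameterization, and let $\operatorname{dgm} M^L,\operatorname{dgm} N^L$ be their persistence diagrams, i.e. the finite multisets of pairs $(b,d)$, $b<d\le\infty$, such that the module is isomorphic to the direct sum of the interval modules $I[b,d)$. Let $d_B\in[0,\infty]$ be the bottleneck distance (with respect to the $\ell^\infty$ distance, where $\infty-\infty=0$ and $|\infty-a|=\infty$ for $a\in\mathbb R$; an unmatched point $(b,d)$ costs $(d-b)/2$). (1) For every vertical line $V\subset\mathbb R^2$ there is a value $\ell\in[0,\infty]$ such that for every point $r\in V$, with $L(r,m_1)$ denoting the line through $r$ with direction $(m_1,1)$, $0<m_1<1$, $$\lim_{m_1\to0^+}\hat m^{L(r,m_1)}\,d_B\bigl(\operatorname{dgm}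 M^{L(r,m_1)},\operatorname{dgm} N^{L(r,m_1)}\bigr)=\ell .$$ That is, the limit exists and does not depend on the point $r$ of $V$. Moreover, $\ell<\infty$ as soon as $d_B(\operatorname{dgm} M^L,\operatorname{dgm} N^L)<\infty$ for at least one line $L$ of positive slope. (2) The same holds for every horizontal line $H\subset\mathbb R^2$, with the lines through $r\in H$ with direction $(1,m_2)$, $0<m_2<1$, and the limit $m_2\to0^+$. -/

import Mathlib

open scoped ENNReal Topology

universe u v w w'

/-- A persistence module over a preordered parameter space `P` with coefficients in a field `F`:
vector spaces indexed by `P` and functorial transition maps. -/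
structure PersistenceModule (F : Type u) [Field F] (P : Type w) [Preorder P] where
  /-- the vector space at a parameter value -/
  V : P → Type v
  [acg : ∀ a, AddCommGroup (V a)]
  [mod : ∀ a, Module F (V a)]
  /-- the transition maps -/
  map : ∀ {a b : P}, a ≤ b → (V a →ₗ[F] V b)
  map_id : ∀ (a : P) (x : V a), map (le_refl a) x = x
  map_comp : ∀ {a b c : P} (hab : a ≤ b) (hbc : b ≤ c) (x : V a),
    map hbc (map hab x) = map (hab.trans hbc) x

namespace PersistenceModule

attribute [instance] PersistenceModule.acg PersistenceModule.mod

variable {F : Type u} [Field F] {P : Type w} [Preorder P]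

/-- A morphism of persistence modules. -/
structure Hom (M : PersistenceModule.{u, v} F P) (N : PersistenceModule.{u, w'} F P) where
  app : ∀ a, M.V a →ₗ[F] N.V a
  naturality : ∀ {a b : P} (h : a ≤ b) (x : M.V a), app b (M.map h x) = N.map h (app a x)

/-- An isomorphism of persistence modules. -/
structure Iso (M : PersistenceModule.{u, v} F P) (N : PersistenceModule.{u, w'} F P) where
  app : ∀ a, M.V a ≃ₗ[F] N.V a
  naturality : ∀ {a b : P} (h : a ≤ b) (x : M.V a), app b (M.map h x) = N.map h (app a x)

/-- The direct sum of a family of persistence modules indexed by a finite type. -/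
def directSum {ι : Type} [Finite ι] (I : ι → PersistenceModule.{u, v} F P) :
    PersistenceModule.{u, v} F P where
  V a := ∀ j, (I j).V a
  map h := LinearMap.pi fun j => (I j).map h ∘ₗ LinearMap.proj j
  map_id a x := by
    funext j
    exact (I j).map_id a (x j)
  map_comp hab hbc x := by
    funext j
    exact (I j).map_comp hab hbc (x j)

/-- The coefficient vectors on `n` generators of grades `g i` that are supported on the generators
already born at the parameter value `a`. -/
def freeSpace (F : Type u) [Field F] {n : ℕ} (g : Fin n → P) (a : P) : Submodule F (Fin n → F) where
  carrier := {c | ∀ i, ¬ g i ≤ a → c i = 0}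
  zero_mem' := fun _ _ => rfl
  add_mem' := by
    intro c d hc hd i hi
    simp [hc i hi, hd i hi]
  smul_mem' := by
    intro t c hc i hi
    simp [hc i hi]

/-- The free persistence module on `n` generators of grades `g i`. -/
def free (F : Type u) [Field F] {n : ℕ} (g : Fin n → P) : PersistenceModule.{u, u} F P where
  V a := freeSpace F g a
  map hab := Submodule.inclusion fun _ hc i hi => hc i fun h => hi (h.trans hab)
  map_id _ _ := rfl
  map_comp _ _ _ := rfl

/-- `M` is finitely presented: there is an exact sequence `F₁ ⟶ F₀ ⟶ M ⟶ 0` with `F₀`, `F₁` free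
on finitely many generators. -/
def IsFinitelyPresented (M : PersistenceModule.{u, v} F P) : Prop :=
  ∃ (n k : ℕ) (g : Fin n → P) (h : Fin k → P)
    (φ : Hom (free F h) (free F g)) (ψ : Hom (free F g) M),
    ∀ a, Function.Surjective (ψ.app a) ∧ LinearMap.ker (ψ.app a) = LinearMap.range (φ.app a)

end PersistenceModule

/-- A point of the extended half plane `ℝ × (ℝ ∪ {∞})`: a birth and a death value. -/
abbrev DgmPoint : Type := ℝ × WithTop ℝ

/-- The space at `s` of the interval module `I[b,d)`: all of `F` if `b ≤ s < d`, and `0` else. -/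
def intervalSpace (F : Type u) [Field F] (p : DgmPoint) (s : ℝ) : Submodule F F where
  carrier := {x | ¬ (p.1 ≤ s ∧ (s : WithTop ℝ) < p.2) → x = 0}
  zero_mem' := fun _ => rfl
  add_mem' := by
    intro x y hx hy h
    simp [hx h, hy h]
  smul_mem' := by
    intro t x hx h
    simp [hx h]

open Classical in
/-- The interval module `I[b,d)`, for `p = (b, d)`: its transition map from `s` to `t` is the
identity if `b ≤ s ≤ t < d`, and zero otherwise. -/
noncomputable def intervalModule (F : Type u) [Field F] (p : DgmPoint) :
    PersistenceModule.{u, u} F ℝ where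
  V s := intervalSpace F p s
  map {s t} _ :=
    { toFun := fun x =>
        ⟨if p.1 ≤ t ∧ (t : WithTop ℝ) < p.2 then (x : F) else 0, fun h => if_neg h⟩
      map_add' := by
        intro x y
        ext
        by_cases h : p.1 ≤ t ∧ (t : WithTop ℝ) < p.2 <;> simp [h]
      map_smul' := by
        intro c x
        ext
        by_cases h : p.1 ≤ t ∧ (t : WithTop ℝ) < p.2 <;> simp [h] }
  map_id s x := by
    ext
    by_cases h : p.1 ≤ s ∧ (s : WithTop ℝ) < p.2
    · simp [h]
    · simpa [h] using (x.2 h).symm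
  map_comp {r s t} hrs hst x := by
    ext
    by_cases ht : p.1 ≤ t ∧ (t : WithTop ℝ) < p.2
    · by_cases hs : p.1 ≤ s ∧ (s : WithTop ℝ) < p.2
      · simp [ht, hs]
      · have hr : ¬ (p.1 ≤ r ∧ (r : WithTop ℝ) < p.2) := fun hr =>
          hs ⟨hr.1.trans hrs, lt_of_le_of_lt (WithTop.coe_le_coe.2 hst) ht.2⟩
        simpa [ht, hs] using (x.2 hr).symm
    · simp [ht]

/-- `D` is a persistence diagram of the one-parameter module `M`: `M` is isomorphic to the direct
sum of the interval modules `I[b,d)`, where `(b,d)` runs through the finite multiset `D`, and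
`b < d` for each of them. -/
def IsPersistenceDiagram {F : Type u} [Field F] (M : PersistenceModule.{u, v} F ℝ)
    (D : Multiset DgmPoint) : Prop :=
  (∀ p ∈ D, (p.1 : WithTop ℝ) < p.2) ∧
  ∃ (n : ℕ) (p : Fin n → DgmPoint), D = Finset.univ.val.map p ∧
    Nonempty (PersistenceModule.Iso M
      (PersistenceModule.directSum fun j => intervalModule F (p j)))

open Classical in
/-- The persistence diagram of a one-parameter persistence module (with the value `0` if the module
is not a finite direct sum of interval modules). -/
noncomputable def dgm {F : Type u} [Field F] (M : PersistenceModule.{u, v} F ℝ) :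
    Multiset DgmPoint :=
  if h : ∃ D, IsPersistenceDiagram M D then h.choose else 0

/-- Distance on `ℝ ∪ {∞}`, with `∞ - ∞ = 0` and `|∞ - a| = ∞` for real `a`. -/
noncomputable def deathDist : WithTop ℝ → WithTop ℝ → ℝ≥0∞
  | some a, some b => edist a b
  | none, none => 0
  | some _, none => ⊤
  | none, some _ => ⊤

/-- The `ℓ^∞` distance between two points of `ℝ × (ℝ ∪ {∞})`. -/
noncomputable def pointDist (p q : DgmPoint) : ℝ≥0∞ :=
  max (edist p.1 q.1) (deathDist p.2 q.2)

/-- The `ℓ^∞` distance `(d - b) / 2` of the point `(b, d)` to the diagonal, `∞` if `d = ∞`. -/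
noncomputable def diagDist : DgmPoint → ℝ≥0∞
  | (b, some d) => ENNReal.ofReal ((d - b) / 2)
  | (_, none) => ⊤

/-- A matching between the multisets `D` and `E`: a bijection between a multi-subset of `D` and a
multi-subset of `E`, given as a multiset of pairs, together with the unmatched points of both. -/
structure DgmMatching (D E : Multiset DgmPoint) where
  pairs : Multiset (DgmPoint × DgmPoint)
  unmatchedLeft : Multiset DgmPoint
  unmatchedRight : Multiset DgmPoint
  left_eq : pairs.map Prod.fst + unmatchedLeft = D
  right_eq : pairs.map Prod.snd + unmatchedRight = E

/-- The cost of a matching: the largest cost of a matched pair or of an unmatched point. -/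
noncomputable def DgmMatching.cost {D E : Multiset DgmPoint} (σ : DgmMatching D E) : ℝ≥0∞ :=
  max (σ.pairs.map fun x => pointDist x.1 x.2).sup
    ((σ.unmatchedLeft + σ.unmatchedRight).map diagDist).sup

/-- The bottleneck distance (the infimum runs over the finitely many matchings). -/
noncomputable def bottleneckDist (D E : Multiset DgmPoint) : ℝ≥0∞ :=
  ⨅ σ : DgmMatching D E, σ.cost

/-- A line of positive slope in the plane, `s ↦ s m + b`, in standard normalization. -/
structure PosLine where
  m : ℝ × ℝ
  b : ℝ × ℝ
  m_fst_pos : 0 < m.1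
  m_snd_pos : 0 < m.2
  max_m : max m.1 m.2 = 1
  sum_b : b.1 + b.2 = 0

namespace PosLine

/-- The point of the line with parameter `s`. -/
def point (L : PosLine) (s : ℝ) : ℝ × ℝ := s • L.m + L.b

/-- The weight of the line: the minimal coordinate of its direction. -/
noncomputable def weight (L : PosLine) : ℝ := min L.m.1 L.m.2

theorem point_mono (L : PosLine) {s t : ℝ} (h : s ≤ t) : L.point s ≤ L.point t := by
  constructor
  · simpa [point] using mul_le_mul_of_nonneg_right h L.m_fst_pos.le
  · simpa [point] using mul_le_mul_of_nonneg_right h L.m_snd_pos.le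

/-- The line through the point `r` with direction `m`, in standard normalization. -/
noncomputable def through (r m : ℝ × ℝ) (h₁ : 0 < m.1) (h₂ : 0 < m.2) (hm : max m.1 m.2 = 1) :
    PosLine where
  m := m
  b := r - ((r.1 + r.2) / (m.1 + m.2)) • m
  m_fst_pos := h₁
  m_snd_pos := h₂
  max_m := hm
  sum_b := by
    have : m.1 + m.2 ≠ 0 := (add_pos h₁ h₂).ne'
    simp only [Prod.fst_sub, Prod.snd_sub, Prod.smul_fst, Prod.smul_snd, smul_eq_mul]
    field_simp
    ring

/-- The point `r` does lie on the line `through r m`. -/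
theorem exists_point_through (r m : ℝ × ℝ) (h₁ : 0 < m.1) (h₂ : 0 < m.2) (hm : max m.1 m.2 = 1) :
    ∃ s, (through r m h₁ h₂ hm).point s = r :=
  ⟨(r.1 + r.2) / (m.1 + m.2), by simp [point, through]⟩

/-- The line through `r` with direction `(m₁, 1)`, where `0 < m₁ < 1`. -/
noncomputable def steep (r : ℝ × ℝ) (m₁ : Set.Ioo (0 : ℝ) 1) : PosLine :=
  through r (m₁, 1) m₁.2.1 one_pos (max_eq_right m₁.2.2.le)

/-- The line through `r` with direction `(1, m₂)`, where `0 < m₂ < 1`. -/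
noncomputable def shallow (r : ℝ × ℝ) (m₂ : Set.Ioo (0 : ℝ) 1) : PosLine :=
  through r (1, m₂) one_pos m₂.2.1 (max_eq_left m₂.2.2.le)

end PosLine

/-- The restriction of a two-parameter persistence module to a line of positive slope. -/
def PersistenceModule.restrict {F : Type u} [Field F] (M : PersistenceModule.{u, v} F (ℝ × ℝ))
    (L : PosLine) : PersistenceModule.{u, v} F ℝ where
  V s := M.V (L.point s)
  map h := M.map (L.point_mono h)
  map_id s x := M.map_id (L.point s) x
  map_comp hrs hst x := M.map_comp (L.point_mono hrs) (L.point_mono hst) x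

/-- The weighted bottleneck distance of `M` and `N` along the line `L`. -/
noncomputable def weightedDist {F : Type u} [Field F] (M : PersistenceModule.{u, v} F (ℝ × ℝ))
    (N : PersistenceModule.{u, w} F (ℝ × ℝ)) (L : PosLine) : ℝ≥0∞ :=
  ENNReal.ofReal L.weight * bottleneckDist (dgm (M.restrict L)) (dgm (N.restrict L))

/-- The vertical line with first coordinate `x`. -/
def verticalLine (x : ℝ) : Set (ℝ × ℝ) := {r | r.1 = x}

/-- The horizontal line with second coordinate `y`. -/
def horizontalLine (y : ℝ) : Set (ℝ × ℝ) := {r | r.2 = y}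

/-- The filter `t → 0⁺` on the open interval `(0, 1)`. -/
def zeroPlus : Filter (Set.Ioo (0 : ℝ) 1) := Filter.comap Subtype.val (𝓝[>] (0 : ℝ))

/-!
Restricted to the steep line `s ↦ r + (s - c) (m, 1)`, a finitely presented module `M` vanishes
below all grades, then crosses the finitely many second coordinates of the grades within a bounded
parameter interval, and from there on changes only where the first coordinate `r.1 + m (s - c)`
passes that of a grade. After the parameter is rescaled by `m`, which multiplies the bottleneck
distance by the weight `m` of the line, the bounded interval shrinks to length `O(m)` around `0`,
and what remains is the persistence diagram of the ranks of `M` along the horizontal ray from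
`(r.1, Y)`, with `Y` above all grades. That ray diagram depends only on the vertical line through
`r`, and the rescaled diagram is within bottleneck distance `O(m)` of it
(`IsGradedRank.exists_isRayDiagram`). By the triangle inequality the weighted distances converge to
the distance of the ray diagrams of `M` and `N` (`exists_tendsto_bottleneckDist`).

No ray module is needed: the ray diagram is the collapsed diagram of any line with `m` small, and it
is well defined since a diagram is determined by its ranks (`eq_of_aliveCount_eq`). That the points
of a diagram count the ranks of the transition maps is `IsPersistenceDiagram.card_filter`; that a
diagram exists at all rests on the fact that two chains of subspaces of a finite-dimensional space
have a common adapted basis (`exists_linearIndependent_adapted`), applied to the generators born and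
the relations present in a presentation
(`PersistenceModule.Presentation.exists_isPersistenceDiagram`). For the triangle inequality,
matchings are replaced by complete matchings of diagrams padded with points of the diagonal
(`IsNear`), which compose.

The limit is finite if one of the distances is: a bottleneck distance is finite exactly if both
diagrams have the same number of points at infinity, and this number is the rank of the module
above all grades, for every line. Shallow lines become steep under the reflection in the diagonal,
which acts on rank functions (`IsGradedRank.swap`).
-/

/-! ### Linear algebra: bases adapted to two chains of subspaces -/

theorem LinearMap.finrank_range_eq_of_ker_eq {F V W W' : Type*} [Field F]
    [AddCommGroup V] [Module F V] [AddCommGroup W] [Module F W] [AddCommGroup W'] [Module F W']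
    (f : V →ₗ[F] W) (g : V →ₗ[F] W') (h : LinearMap.ker f = LinearMap.ker g) :
    Module.finrank F (LinearMap.range f) = Module.finrank F (LinearMap.range g) :=
  (f.quotKerEquivRange.symm.trans
    ((Submodule.quotEquivOfEq _ _ h).trans g.quotKerEquivRange)).finrank_eq

/-- Two chains of subspaces of a finite-dimensional space have a common adapted basis. The
induction runs over the subspace `H` to be filled: a hyperplane `H'` of `H` is chosen that contains
the trace of every member of the first chain not containing `H`, and the new basis vector is taken
from the smallest member of the second chain whose trace leaves `H'`. -/
theorem exists_linearIndependent_adapted {F V : Type*} [Field F] [AddCommGroup V] [Module F V]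
    [FiniteDimensional F V] (𝒜 ℬ : Set (Submodule F V))
    (h𝒜 : IsChain (· ≤ ·) 𝒜) (hℬ : IsChain (· ≤ ·) ℬ) (H : Submodule F V) :
    ∃ (n : ℕ) (e : Fin n → V), LinearIndependent F e ∧ (∀ i, e i ∈ H) ∧
      ∀ U ∈ 𝒜 ∪ ℬ, U ⊓ H ≤ Submodule.span F (e '' {i | e i ∈ U}) := by
  induction H using WellFoundedLT.induction with
  | ind H ih =>
  by_cases hH : H = ⊥
  · subst hH
    exact ⟨0, Fin.elim0, linearIndependent_empty_type, fun i => i.elim0, fun U _ => by simp⟩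
  -- the largest trace of a member of `𝒜` that is proper in `H`
  obtain ⟨X, hXS, hXmax⟩ := (wellFounded_gt (α := Submodule F V)).has_min
    ({X | ∃ U ∈ 𝒜, ¬ H ≤ U ∧ X = U ⊓ H} ∪ {⊥}) ⟨⊥, Or.inr rfl⟩
  have hXH : X < H := by
    rcases hXS with ⟨U, -, hU, rfl⟩ | rfl
    · exact lt_of_le_of_ne inf_le_right fun h => hU (h ▸ inf_le_left)
    · exact bot_lt_iff_ne_bot.2 hH
  have hX : ∀ U ∈ 𝒜, ¬ H ≤ U → U ⊓ H ≤ X := by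
    intro U hU hHU
    by_contra hcon
    refine hXmax (U ⊓ H) (Or.inl ⟨U, hU, hHU, rfl⟩) ?_
    rcases hXS with ⟨U', hU', -, rfl⟩ | rfl
    · rcases h𝒜.total hU hU' with h | h
      · exact absurd (inf_le_inf_right H h) hcon
      · exact lt_of_le_not_ge (inf_le_inf_right H h) hcon
    · exact bot_lt_iff_ne_bot.2 fun h => hcon h.le
  -- a hyperplane of `H` above it
  obtain ⟨H', ⟨hXH', hH'H⟩, hH'max⟩ := (wellFounded_gt (α := Submodule F V)).has_min
    {Y | X ≤ Y ∧ Y < H} ⟨X, le_rfl, hXH⟩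
  obtain ⟨n, e, he, heH, hspan⟩ := ih H' hH'H
  obtain ⟨z, hzH, hzH', hz⟩ : ∃ z ∈ H, z ∉ H' ∧ ∀ U ∈ ℬ, ¬ U ⊓ H ≤ H' → z ∈ U := by
    by_cases hex : ∃ U ∈ ℬ, ¬ U ⊓ H ≤ H'
    · obtain ⟨Z, ⟨hZ, hZH⟩, hZmin⟩ := (wellFounded_lt (α := Submodule F V)).has_min
        {U | U ∈ ℬ ∧ ¬ U ⊓ H ≤ H'} hex
      obtain ⟨z, hz, hz'⟩ := SetLike.not_le_iff_exists.1 hZH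
      refine ⟨z, hz.2, hz', fun U hU hUH => ?_⟩
      rcases hℬ.total hZ hU with h | h
      · exact h hz.1
      · rcases h.lt_or_eq with h | h
        · exact absurd h (hZmin U ⟨hU, hUH⟩)
        · exact h ▸ hz.1
    · obtain ⟨z, hz, hz'⟩ := SetLike.exists_of_lt hH'H
      exact ⟨z, hz, hz', fun U hU hUH => absurd ⟨U, hU, hUH⟩ hex⟩
  have hdec : ∀ x ∈ H, ∃ y ∈ H', ∃ c : F, x = y + c • z := by
    have hsup : H' ⊔ Submodule.span F {z} = H := by
      by_contra hne
      have hle : H' ⊔ Submodule.span F {z} ≤ H :=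
        sup_le hH'H.le ((Submodule.span_singleton_le_iff_mem _ _).2 hzH)
      refine hH'max _ ⟨hXH'.trans le_sup_left, lt_of_le_of_ne hle hne⟩ ?_
      refine lt_of_le_of_ne le_sup_left fun h => hzH' ?_
      rw [h]
      exact Submodule.mem_sup_right (Submodule.mem_span_singleton_self z)
    intro x hx
    rw [← hsup] at hx
    obtain ⟨y, hy, w, hw, rfl⟩ := Submodule.mem_sup.1 hx
    obtain ⟨c, rfl⟩ := Submodule.mem_span_singleton.1 hw
    exact ⟨y, hy, c, rfl⟩
  refine ⟨n + 1, Fin.cons z e, ?_, ?_, ?_⟩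
  · refine linearIndependent_finCons.2 ⟨he, fun hmem => hzH' ?_⟩
    exact (Submodule.span_le.2 (Set.range_subset_iff.2 heH)) hmem
  · intro i
    refine Fin.cases hzH (fun j => ?_) i
    simpa using hH'H.le (heH j)
  · intro U hU
    have hold : U ⊓ H' ≤ Submodule.span F
        ((Fin.cons z e : Fin (n + 1) → V) '' {i | (Fin.cons z e : Fin (n + 1) → V) i ∈ U}) := by
      refine (hspan U hU).trans (Submodule.span_mono ?_)
      rintro _ ⟨i, hi, rfl⟩
      exact ⟨i.succ, by simpa using hi, by simp⟩
    by_cases hUH : U ⊓ H ≤ H'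
    · exact (le_inf inf_le_left hUH).trans hold
    · have hzU : z ∈ U := by
        rcases hU with hU | hU
        · by_contra hzU
          exact hUH ((hX U hU fun h => hzU (h hzH)).trans hXH')
        · exact hz U hU hUH
      rintro x ⟨hxU, hxH⟩
      obtain ⟨y, hy, c, rfl⟩ := hdec x hxH
      have hyU : y ∈ U := by
        have := U.sub_mem hxU (U.smul_mem c hzU)
        simpa using this
      refine Submodule.add_mem _ (hold ⟨hyU, hy⟩) (Submodule.smul_mem _ c ?_)
      exact Submodule.subset_span ⟨0, by simpa using hzU, by simp⟩

/-! ### Presentations -/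

namespace PersistenceModule

variable {F : Type u} [Field F] {P : Type w} [Preorder P]

/-- A finite presentation of `M` in coordinates: generators of grades `g i`, relations of grades
`h i` given by coefficient vectors `rel i`, and the projection of the free module onto `M`. -/
structure Presentation (M : PersistenceModule.{u, v} F P) where
  n : ℕ
  k : ℕ
  g : Fin n → P
  h : Fin k → P
  rel : Fin k → Fin n → F
  proj : ∀ p, freeSpace F g p →ₗ[F] M.V p
  proj_surjective : ∀ p, Function.Surjective (proj p)
  map_proj : ∀ {p q : P} (hpq : p ≤ q) (c : Fin n → F) (hp : c ∈ freeSpace F g p)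
    (hq : c ∈ freeSpace F g q), M.map hpq (proj p ⟨c, hp⟩) = proj q ⟨c, hq⟩
  proj_eq_zero : ∀ (p : P) (c : freeSpace F g p),
    proj p c = 0 ↔ (c : Fin n → F) ∈ Submodule.span F (rel '' {i | h i ≤ p})

theorem freeSpace_mono {n : ℕ} (g : Fin n → P) {p q : P} (hpq : p ≤ q) :
    freeSpace F g p ≤ freeSpace F g q :=
  fun _ hc i hi => hc i fun h => hi (h.trans hpq)

open Classical in
theorem single_mem_freeSpace {n : ℕ} (g : Fin n → P) {i : Fin n} {p : P} (hi : g i ≤ p) :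
    (Pi.single i 1 : Fin n → F) ∈ freeSpace F g p := by
  intro j hj
  rw [Pi.single_apply, if_neg]
  rintro rfl
  exact hj hi

theorem IsFinitelyPresented.nonempty_presentation {M : PersistenceModule.{u, v} F P}
    (hM : M.IsFinitelyPresented) : Nonempty M.Presentation := by
  classical
  obtain ⟨n, k, g, h, φ, ψ, hex⟩ := hM
  -- the components of `φ` and `ψ` as maps between the concrete spaces of coefficient vectors
  let α : ∀ p, freeSpace F h p →ₗ[F] freeSpace F g p := φ.app
  let β : ∀ p, freeSpace F g p →ₗ[F] M.V p := ψ.app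
  have hα : ∀ {p q : P} (_ : p ≤ q) (c : Fin k → F) (hp : c ∈ freeSpace F h p)
      (hq : c ∈ freeSpace F h q), (α q ⟨c, hq⟩).1 = (α p ⟨c, hp⟩).1 :=
    fun hpq c hp _ => congrArg Subtype.val (φ.naturality hpq ⟨c, hp⟩)
  have hβ : ∀ {p q : P} (hpq : p ≤ q) (c : Fin n → F) (hp : c ∈ freeSpace F g p)
      (hq : c ∈ freeSpace F g q), M.map hpq (β p ⟨c, hp⟩) = β q ⟨c, hq⟩ :=
    fun hpq c hp _ => (ψ.naturality hpq ⟨c, hp⟩).symm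
  have hsurj : ∀ p, Function.Surjective (β p) := fun p => (hex p).1
  have hker : ∀ p (c : freeSpace F g p), β p c = 0 ↔ ∃ x, α p x = c := fun p c =>
    SetLike.ext_iff.1 (hex p).2 c
  clear_value α β
  let col : Fin k → Fin n → F := fun i =>
    (α (h i) ⟨Pi.single i 1, single_mem_freeSpace h le_rfl⟩).1
  have hcol : ∀ (i : Fin k) (p : P) (hi : h i ≤ p),
      (α p ⟨Pi.single i 1, single_mem_freeSpace h hi⟩).1 = col i :=
    fun i p hi => hα hi _ _ _
  have hsum : ∀ (p : P) (c : freeSpace F h p), (α p c).1 = ∑ i, c.1 i • col i := by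
    intro p c
    have hc : c = ∑ i, if hi : h i ≤ p then
        c.1 i • (⟨Pi.single i 1, single_mem_freeSpace h hi⟩ : freeSpace F h p) else 0 := by
      ext j
      rw [AddSubmonoidClass.coe_finsetSum, Finset.sum_apply, Finset.sum_eq_single j]
      · split_ifs with hj
        · simp
        · simp [c.2 j hj]
      · intro i _ hij
        split_ifs
        · simp [hij.symm]
        · rfl
      · simp
    conv_lhs => rw [hc]
    rw [map_sum, AddSubmonoidClass.coe_finsetSum]
    refine Finset.sum_congr rfl fun i _ => ?_
    split_ifs with hi
    · rw [map_smul, ← hcol i p hi]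
      rfl
    · simp [c.2 i hi]
  refine ⟨⟨n, k, g, h, col, β, hsurj, hβ, ?_⟩⟩
  intro p c
  rw [hker]
  constructor
  · rintro ⟨x, rfl⟩
    rw [hsum]
    refine Submodule.sum_mem _ fun i _ => ?_
    by_cases hi : h i ≤ p
    · exact Submodule.smul_mem _ _ (Submodule.subset_span ⟨i, hi, rfl⟩)
    · simp [show x.1 i = 0 from x.2 i hi]
  · intro hc
    have hle : Submodule.span F (col '' {i | h i ≤ p}) ≤
        (LinearMap.range (α p)).map (freeSpace F g p).subtype := by
      rw [Submodule.span_le]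
      rintro _ ⟨i, hi, rfl⟩
      exact ⟨_, ⟨⟨Pi.single i 1, single_mem_freeSpace h hi⟩, rfl⟩, hcol i p hi⟩
    obtain ⟨_, ⟨x, rfl⟩, hx⟩ := hle hc
    exact ⟨x, Subtype.ext hx⟩

namespace Presentation

variable {M : PersistenceModule.{u, v} F P} (X : M.Presentation)

/-- The coefficient vectors of the elements that vanish in `M` at the parameter value `p`. -/
def relSpace (p : P) : Submodule F (Fin X.n → F) := Submodule.span F (X.rel '' {i | X.h i ≤ p})

theorem relSpace_mono {p q : P} (hpq : p ≤ q) : X.relSpace p ≤ X.relSpace q :=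
  Submodule.span_mono (Set.image_mono fun _ hi => le_trans hi hpq)

/-- The right-hand side depends only on the generators born at `p` and the relations at `q`. -/
theorem finrank_range_map {p q : P} (hpq : p ≤ q) :
    Module.finrank F (LinearMap.range (M.map hpq)) =
      Module.finrank F ((freeSpace F X.g p).map (X.relSpace q).mkQ) := by
  have h1 : LinearMap.range (M.map hpq) = LinearMap.range (M.map hpq ∘ₗ X.proj p) := by
    rw [LinearMap.range_comp, LinearMap.range_eq_top.2 (X.proj_surjective p), Submodule.map_top]
  have h2 : (freeSpace F X.g p).map (X.relSpace q).mkQ =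
      LinearMap.range ((X.relSpace q).mkQ ∘ₗ (freeSpace F X.g p).subtype) := by
    rw [LinearMap.range_comp, Submodule.range_subtype]
  rw [h1, h2]
  refine LinearMap.finrank_range_eq_of_ker_eq _ _ ?_
  ext c
  simp only [LinearMap.mem_ker, LinearMap.comp_apply, Submodule.mkQ_apply,
    Submodule.Quotient.mk_eq_zero, Submodule.subtype_apply]
  rw [← Subtype.coe_eta c c.2, X.map_proj hpq c.1 c.2 (freeSpace_mono X.g hpq c.2),
    X.proj_eq_zero]
  rfl

end Presentation

end PersistenceModule

/-! ### Isomorphisms -/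

namespace PersistenceModule

variable {F : Type u} [Field F]

theorem Hom.nonempty_iso {P : Type w} [Preorder P] {M : PersistenceModule.{u, v} F P}
    {N : PersistenceModule.{u, w'} F P} (f : Hom M N) (hf : ∀ a, Function.Bijective (f.app a)) :
    Nonempty (Iso N M) := by
  refine ⟨⟨fun a => (LinearEquiv.ofBijective (f.app a) (hf a)).symm, ?_⟩⟩
  intro a b h x
  obtain ⟨y, rfl⟩ := (hf a).2 x
  apply (LinearEquiv.ofBijective (f.app b) (hf b)).injective
  rw [LinearEquiv.apply_symm_apply]
  have h1 : (LinearEquiv.ofBijective (f.app a) (hf a)).symm (f.app a y) = y :=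
    (LinearEquiv.ofBijective (f.app a) (hf a)).symm_apply_apply y
  rw [h1]
  exact (f.naturality h y).symm

theorem Iso.finrank_range_map {P : Type w} [Preorder P] {M : PersistenceModule.{u, v} F P}
    {N : PersistenceModule.{u, w'} F P} (f : Iso M N) {a b : P} (h : a ≤ b) :
    Module.finrank F (LinearMap.range (M.map h)) =
      Module.finrank F (LinearMap.range (N.map h)) := by
  have h1 : LinearMap.range (N.map h) = LinearMap.range (N.map h ∘ₗ (f.app a).toLinearMap) := by
    rw [LinearMap.range_comp, LinearEquiv.range, Submodule.map_top]
  rw [h1]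
  refine LinearMap.finrank_range_eq_of_ker_eq _ _ ?_
  ext x
  simp only [LinearMap.mem_ker, LinearMap.comp_apply, LinearEquiv.coe_coe]
  rw [← f.naturality h x, LinearEquiv.map_eq_zero_iff]

end PersistenceModule

/-! ### Restriction to lines of positive slope -/

namespace PosLine

/-- The parameter at which the line enters the quadrant above `g`. -/
noncomputable def push (L : PosLine) (g : ℝ × ℝ) : ℝ :=
  max ((g.1 - L.b.1) / L.m.1) ((g.2 - L.b.2) / L.m.2)

theorem push_le_iff (L : PosLine) (g : ℝ × ℝ) (s : ℝ) : L.push g ≤ s ↔ g ≤ L.point s := by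
  rw [push, max_le_iff, div_le_iff₀ L.m_fst_pos, div_le_iff₀ L.m_snd_pos, Prod.le_def]
  simp [point]

end PosLine

namespace PersistenceModule

variable {F : Type u} [Field F]

theorem freeSpace_push (L : PosLine) {n : ℕ} (g : Fin n → ℝ × ℝ) (s : ℝ) :
    freeSpace F (fun i => L.push (g i)) s = freeSpace F g (L.point s) := by
  ext c
  exact forall_congr' fun i => by rw [L.push_le_iff]

/-- The presentation of the restriction to a line, with the grades pushed onto the line. -/
noncomputable def Presentation.restrict {M : PersistenceModule.{u, v} F (ℝ × ℝ)}
    (X : M.Presentation) (L : PosLine) : (M.restrict L).Presentation where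
  n := X.n
  k := X.k
  g i := L.push (X.g i)
  h i := L.push (X.h i)
  rel := X.rel
  proj s := X.proj (L.point s) ∘ₗ Submodule.inclusion (freeSpace_push L X.g s).le
  proj_surjective s := by
    intro x
    obtain ⟨c, hc⟩ := X.proj_surjective (L.point s) x
    exact ⟨⟨c.1, (freeSpace_push L X.g s).ge c.2⟩, hc⟩
  map_proj hpq c _ _ := X.map_proj (L.point_mono hpq) c _ _
  proj_eq_zero s c := by
    simp only [L.push_le_iff]
    exact X.proj_eq_zero (L.point s) ⟨c.1, (freeSpace_push L X.g s).le c.2⟩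

/-! ### Interval decomposition of finitely presented one-parameter modules -/

/-- An up-closed set of reals that is entered only at one of finitely many values `h i` is empty or
of the form `[d, ∞)`. -/
theorem exists_threshold {ι : Type*} [Finite ι] (h : ι → ℝ) (T : Set ℝ)
    (hT : ∀ s ∈ T, ∃ i, h i ≤ s ∧ h i ∈ T) (hup : ∀ s ∈ T, ∀ t, s ≤ t → t ∈ T) :
    ∃ d : WithTop ℝ, ∀ s : ℝ, s ∈ T ↔ d ≤ s := by
  by_cases hne : {i | h i ∈ T}.Nonempty
  · obtain ⟨i, hi, hmin⟩ := Set.exists_min_image _ h (Set.toFinite {i | h i ∈ T}) hne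
    refine ⟨(h i : ℝ), fun s => ⟨fun hs => ?_, fun hs => hup _ hi s (WithTop.coe_le_coe.1 hs)⟩⟩
    obtain ⟨j, hj, hjT⟩ := hT s hs
    exact WithTop.coe_le_coe.2 ((hmin j hjT).trans hj)
  · refine ⟨⊤, fun s => ⟨fun hs => ?_, fun hs => ?_⟩⟩
    · obtain ⟨j, -, hjT⟩ := hT s hs
      exact absurd ⟨j, hjT⟩ hne
    · exact absurd hs (by simp)

theorem exists_last_le {ι : Type*} [Finite ι] (h : ι → ℝ) {s : ℝ} (hs : ∃ i, h i ≤ s) :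
    ∃ i, h i ≤ s ∧ ∀ j, h j ≤ h i ↔ h j ≤ s := by
  obtain ⟨i, hi, hmax⟩ := Set.exists_max_image _ h (Set.toFinite {i | h i ≤ s}) hs
  exact ⟨i, hi, fun j => ⟨fun hj => hj.trans hi, fun hj => hmax j hj⟩⟩

namespace Presentation

variable {W : PersistenceModule.{u, v} F ℝ} (X : W.Presentation)

theorem exists_birth {c : Fin X.n → F} (hc : c ≠ 0) :
    ∃ b : ℝ, ∀ s, c ∈ freeSpace F X.g s ↔ b ≤ s := by
  obtain ⟨b, hb⟩ := exists_threshold X.g {s | c ∈ freeSpace F X.g s} (by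
    intro s hs
    have hne : ∃ i, X.g i ≤ s := by
      by_contra! hne
      exact hc (funext fun i => hs i (not_le.2 (hne i)))
    obtain ⟨i, hi, hiff⟩ := exists_last_le X.g hne
    exact ⟨i, hi, fun j hj => hs j (by rwa [← hiff])⟩)
    (fun s hs t hst => freeSpace_mono X.g hst hs)
  have hbt : b ≠ ⊤ := by
    rintro rfl
    obtain ⟨s, hs⟩ := (Set.finite_range X.g).bddAbove
    have : c ∈ freeSpace F X.g s := fun i hi => absurd (hs ⟨i, rfl⟩) hi
    exact absurd ((hb s).1 this) (by simp)
  lift b to ℝ using hbt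
  exact ⟨b, fun s => (hb s).trans WithTop.coe_le_coe⟩

theorem exists_death {c : Fin X.n → F} (hc : c ≠ 0) :
    ∃ d : WithTop ℝ, ∀ s : ℝ, c ∉ X.relSpace s ↔ s < d := by
  obtain ⟨d, hd⟩ := exists_threshold X.h {s | c ∈ X.relSpace s} (by
    intro s hs
    have hne : ∃ i, X.h i ≤ s := by
      by_contra! hne
      refine hc ?_
      have hempty : {i | X.h i ≤ s} = ∅ :=
        Set.eq_empty_of_forall_notMem fun i hi => (hne i).not_ge hi
      simpa [relSpace, hempty] using hs
    obtain ⟨i, hi, hiff⟩ := exists_last_le X.h hne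
    refine ⟨i, hi, ?_⟩
    simpa only [Set.mem_ofPred_eq, relSpace, hiff] using hs)
    (fun s hs t hst => X.relSpace_mono hst hs)
  exact ⟨d, fun s => by rw [← not_le, ← hd]; rfl⟩

/-- A basis of the space of coefficient vectors adapted both to the generators born and to the
relations present at the parameter values splits the module into interval modules: each basis
vector lives from its birth as a coefficient vector until it becomes a relation. -/
theorem exists_isPersistenceDiagram (X : W.Presentation) : ∃ D, IsPersistenceDiagram W D := by
  classical
  obtain ⟨n, e, he, -, hspan⟩ := exists_linearIndependent_adapted
    (Set.range (freeSpace F X.g)) (Set.range X.relSpace)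
    (Monotone.isChain_range fun _ _ h => freeSpace_mono X.g h)
    (Monotone.isChain_range fun _ _ h => X.relSpace_mono h) ⊤
  choose b hb using fun i => X.exists_birth (he.ne_zero i)
  choose d hd using fun i => X.exists_death (he.ne_zero i)
  -- the basis vectors that become relations at birth do not contribute
  let J := {i : Fin n // (b i : WithTop ℝ) < d i}
  let σ : Fin (Fintype.card J) → Fin n := fun j => ((Fintype.equivFin J).symm j).1
  have hσinj : Function.Injective σ :=
    Subtype.val_injective.comp (Fintype.equivFin J).symm.injective
  let p : Fin (Fintype.card J) → DgmPoint := fun j => (b (σ j), d (σ j))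
  have hp : ∀ j, ((p j).1 : WithTop ℝ) < (p j).2 := fun j => ((Fintype.equivFin J).symm j).2
  refine ⟨Finset.univ.val.map p, ?_, _, p, rfl, ?_⟩
  · intro q hq
    obtain ⟨j, -, rfl⟩ := Multiset.mem_map.1 hq
    exact hp j
  let τ : ∀ s, (∀ j, intervalSpace F (p j) s) →ₗ[F] (Fin X.n → F) := fun s =>
    ∑ j, LinearMap.toSpanSingleton F _ (e (σ j)) ∘ₗ (intervalSpace F (p j) s).subtype ∘ₗ
      LinearMap.proj j
  have hτ : ∀ s x, τ s x = ∑ j, (x j).1 • e (σ j) := by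
    intro s x
    simp [τ, LinearMap.sum_apply]
  have hτA : ∀ s x, τ s x ∈ freeSpace F X.g s := by
    intro s x
    rw [hτ]
    refine Submodule.sum_mem _ fun j _ => ?_
    by_cases hj : (p j).1 ≤ s ∧ (s : WithTop ℝ) < (p j).2
    · exact Submodule.smul_mem _ _ ((hb _ _).2 hj.1)
    · simp [(x j).2 hj]
  let Ψ : ∀ s, (∀ j, intervalSpace F (p j) s) →ₗ[F] W.V s := fun s =>
    X.proj s ∘ₗ (τ s).codRestrict _ (hτA s)
  have hΨ : ∀ s x, Ψ s x = X.proj s ⟨τ s x, hτA s x⟩ := fun _ _ => rfl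
  have hinj : ∀ s, Function.Injective (Ψ s) := by
    intro s
    rw [injective_iff_map_eq_zero]
    intro x hx
    rw [hΨ, X.proj_eq_zero] at hx
    have h1 : τ s x ∈ Submodule.span F (e '' {i | e i ∈ X.relSpace s}) :=
      hspan _ (Or.inr ⟨s, rfl⟩) ⟨hx, trivial⟩
    have h2 : τ s x ∈ Submodule.span F (e '' {i | e i ∉ X.relSpace s}) := by
      rw [hτ]
      refine Submodule.sum_mem _ fun j _ => ?_
      by_cases hj : (p j).1 ≤ s ∧ (s : WithTop ℝ) < (p j).2
      · exact Submodule.smul_mem _ _ (Submodule.subset_span ⟨σ j, (hd _ _).2 hj.2, rfl⟩)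
      · simp [(x j).2 hj]
    have hdisj : Disjoint {i | e i ∈ X.relSpace s} {i | e i ∉ X.relSpace s} :=
      Set.disjoint_left.2 fun i hi hi' => hi' hi
    have h3 : τ s x = 0 := Submodule.disjoint_def.1 (he.disjoint_span_image hdisj) _ h1 h2
    rw [hτ] at h3
    funext j
    exact Subtype.ext (Fintype.linearIndependent_iff.1 (he.comp σ hσinj) _ h3 j)
  have hsurj : ∀ s, Function.Surjective (Ψ s) := by
    intro s y
    obtain ⟨c, rfl⟩ := X.proj_surjective s y
    have key : ∀ c ∈ Submodule.span F (e '' {i | e i ∈ freeSpace F X.g s}),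
        ∃ x, c - τ s x ∈ X.relSpace s := by
      intro c hc
      induction hc using Submodule.span_induction with
      | mem c hc =>
        obtain ⟨i, hi, rfl⟩ := hc
        by_cases hrel : e i ∈ X.relSpace s
        · exact ⟨0, by simpa using hrel⟩
        · have hbi : b i ≤ s := (hb i s).1 hi
          have hdi : (s : WithTop ℝ) < d i := (hd i s).1 hrel
          let j₀ := Fintype.equivFin J ⟨i, (WithTop.coe_le_coe.2 hbi).trans_lt hdi⟩
          have hj₀ : σ j₀ = i := by simp [σ, j₀]
          have hone : (1 : F) ∈ intervalSpace F (p j₀) s := fun h => by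
            refine absurd ⟨?_, ?_⟩ h <;> simpa [p, hj₀]
          refine ⟨Pi.single j₀ ⟨1, hone⟩, ?_⟩
          rw [hτ, Finset.sum_eq_single j₀]
          · simp [hj₀]
          · intro j _ hj
            simp [hj]
          · simp
      | zero => exact ⟨0, by simp⟩
      | add c c' _ _ ih ih' =>
        obtain ⟨x, hx⟩ := ih
        obtain ⟨x', hx'⟩ := ih'
        refine ⟨x + x', ?_⟩
        rw [map_add, add_sub_add_comm]
        exact Submodule.add_mem _ hx hx'
      | smul t c _ ih =>
        obtain ⟨x, hx⟩ := ih
        refine ⟨t • x, ?_⟩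
        rw [map_smul, ← smul_sub]
        exact Submodule.smul_mem _ _ hx
    obtain ⟨x, hx⟩ := key c.1 (hspan _ (Or.inl ⟨s, rfl⟩) ⟨c.2, trivial⟩)
    refine ⟨x, ?_⟩
    have := (X.proj_eq_zero s (c - (⟨τ s x, hτA s x⟩ : freeSpace F X.g s))).2 hx
    rw [map_sub, sub_eq_zero] at this
    exact this.symm
  refine Hom.nonempty_iso (M := directSum fun j => intervalModule F (p j)) (N := W) ⟨Ψ, ?_⟩
    fun s => ⟨hinj s, hsurj s⟩
  intro s t hst (x : ∀ j, intervalSpace F (p j) s)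
  let μ : (∀ j, intervalSpace F (p j) s) →ₗ[F] (∀ j, intervalSpace F (p j) t) :=
    (directSum fun j => intervalModule F (p j)).map hst
  have hμ : ∀ y j, (μ y j : F) =
      if (p j).1 ≤ t ∧ (t : WithTop ℝ) < (p j).2 then (y j : F) else 0 := fun _ _ => rfl
  change Ψ t (μ x) = W.map hst (Ψ s x)
  clear_value μ
  -- the basis vectors of the summands that die between `s` and `t` are relations at `t`
  rw [hΨ, hΨ, X.map_proj hst _ _ (freeSpace_mono X.g hst (hτA s x)), ← sub_eq_zero, ← map_sub,
    X.proj_eq_zero]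
  change τ t (μ x) - τ s x ∈ X.relSpace t
  rw [hτ, hτ, ← Finset.sum_sub_distrib]
  refine Submodule.sum_mem _ fun j _ => ?_
  rw [← sub_smul, hμ]
  split_ifs with hj
  · simp
  · by_cases hjs : (p j).1 ≤ s ∧ (s : WithTop ℝ) < (p j).2
    · refine Submodule.smul_mem _ _ ?_
      by_contra hrel
      exact hj ⟨hjs.1.trans hst, (hd _ _).1 hrel⟩
    · simp [(x j).2 hjs]

end Presentation

/-! ### Diagrams count ranks -/

theorem finrank_range_map_intervals {n : ℕ} (p : Fin n → DgmPoint) {s t : ℝ} (hst : s ≤ t) :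
    Module.finrank F (LinearMap.range
      ((directSum fun j => intervalModule F (p j)).map hst)) =
      Nat.card {j // (p j).1 ≤ s ∧ (t : WithTop ℝ) < (p j).2} := by
  classical
  let J := {j // (p j).1 ≤ s ∧ (t : WithTop ℝ) < (p j).2}
  let f : (∀ j, intervalSpace F (p j) s) →ₗ[F] (J → F) :=
    LinearMap.pi fun j => (intervalSpace F (p j.1) s).subtype ∘ₗ LinearMap.proj j.1
  have hf : ∀ x j, f x j = (x j.1 : F) := fun _ _ => rfl
  have hsurj : Function.Surjective f := by
    intro y
    refine ⟨fun j => ⟨if h : (p j).1 ≤ s ∧ (t : WithTop ℝ) < (p j).2 then y ⟨j, h⟩ else 0, ?_⟩, ?_⟩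
    · intro hj
      exact dif_neg fun h => hj ⟨h.1, (WithTop.coe_le_coe.2 hst).trans_lt h.2⟩
    · funext j
      rw [hf]
      exact dif_pos j.2
  let μ : (∀ j, intervalSpace F (p j) s) →ₗ[F] (∀ j, intervalSpace F (p j) t) :=
    (directSum fun j => intervalModule F (p j)).map hst
  have hμ : ∀ y j, (μ y j : F) =
      if (p j).1 ≤ t ∧ (t : WithTop ℝ) < (p j).2 then (y j : F) else 0 := fun _ _ => rfl
  change Module.finrank F (LinearMap.range μ) = _
  clear_value μ
  have hker : LinearMap.ker μ = LinearMap.ker f := by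
    ext x
    rw [LinearMap.mem_ker, LinearMap.mem_ker]
    constructor
    · intro hx
      funext j
      have := hμ x j.1
      rw [hx, if_pos ⟨j.2.1.trans hst, j.2.2⟩] at this
      exact this.symm
    · intro hx
      funext j
      refine Subtype.ext ((hμ x j).trans ?_)
      split_ifs with hj
      · by_cases hjs : (p j).1 ≤ s
        · exact congrFun hx ⟨j, hjs, hj.2⟩
        · exact (x j).2 fun h => hjs h.1
      · rfl
  -- `μ` kills the same vectors as the projection `f` to the summands alive throughout
  rw [LinearMap.finrank_range_eq_of_ker_eq μ f hker, LinearMap.range_eq_top.2 hsurj, finrank_top,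
    Module.finrank_fintype_fun_eq_card, Nat.card_eq_fintype_card]

open Classical in
theorem _root_.IsPersistenceDiagram.card_filter {W : PersistenceModule.{u, v} F ℝ}
    {D : Multiset DgmPoint} (hD : IsPersistenceDiagram W D) {s t : ℝ} (hst : s ≤ t) :
    (D.filter fun p => p.1 ≤ s ∧ (t : WithTop ℝ) < p.2).card =
      Module.finrank F (LinearMap.range (W.map hst)) := by
  obtain ⟨-, n, p, rfl, ⟨f⟩⟩ := hD
  rw [f.finrank_range_map, finrank_range_map_intervals, Multiset.filter_map, Multiset.card_map,
    Nat.card_eq_fintype_card, Fintype.card_subtype]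
  rfl

end PersistenceModule

theorem IsPersistenceDiagram.dgm {F : Type u} [Field F] {W : PersistenceModule.{u, v} F ℝ}
    (h : ∃ D, IsPersistenceDiagram W D) : IsPersistenceDiagram W (dgm W) := by
  rw [_root_.dgm, dif_pos h]
  exact h.choose_spec

/-! ### Rank functions -/

/-- The rank of the transition map from `p` to `q`, and `0` if `p ≤ q` fails. -/
noncomputable def PersistenceModule.rank {F : Type u} [Field F] {P : Type w} [Preorder P]
    (M : PersistenceModule.{u, v} F P) (p q : P) : ℕ :=
  open Classical in
  if h : p ≤ q then Module.finrank F (LinearMap.range (M.map h)) else 0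

/-- `R p q` is a function of the subsets of the finite set `S` of grades that lie below `p` and
below `q`, and vanishes where there are none: the properties of the rank function of a finitely
presented two-parameter module that determine its behaviour along lines. -/
structure IsGradedRank (R : ℝ × ℝ → ℝ × ℝ → ℕ) (S : Finset (ℝ × ℝ)) : Prop where
  congr : ∀ {p q p' q' : ℝ × ℝ}, p ≤ q → p' ≤ q' → (∀ g ∈ S, g ≤ p ↔ g ≤ p') →
    (∀ g ∈ S, g ≤ q ↔ g ≤ q') → R p q = R p' q'
  self_eq_zero : ∀ p, (∀ g ∈ S, ¬ g ≤ p) → R p p = 0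

theorem IsGradedRank.swap {R : ℝ × ℝ → ℝ × ℝ → ℕ} {S : Finset (ℝ × ℝ)} (h : IsGradedRank R S) :
    IsGradedRank (fun p q => R p.swap q.swap) (S.image Prod.swap) where
  congr hpq hpq' hp hq := by
    refine h.congr (Prod.swap_le_swap.2 hpq) (Prod.swap_le_swap.2 hpq') ?_ ?_
    · intro g hg
      simpa [← Prod.swap_le_swap (x := g)] using hp g.swap (Finset.mem_image_of_mem _ hg)
    · intro g hg
      simpa [← Prod.swap_le_swap (x := g)] using hq g.swap (Finset.mem_image_of_mem _ hg)
  self_eq_zero p hp := by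
    refine h.self_eq_zero _ fun g hg hgp => hp g.swap (Finset.mem_image_of_mem _ hg) ?_
    rw [← Prod.swap_le_swap]
    simpa using hgp

theorem PersistenceModule.IsFinitelyPresented.exists_isGradedRank {F : Type u} [Field F]
    {M : PersistenceModule.{u, v} F (ℝ × ℝ)} (hM : M.IsFinitelyPresented) :
    ∃ S, IsGradedRank M.rank S := by
  classical
  obtain ⟨X⟩ := hM.nonempty_presentation
  refine ⟨Finset.univ.image X.g ∪ Finset.univ.image X.h, ?_, ?_⟩
  · intro p q p' q' hpq hpq' hp hq
    have hA : freeSpace F X.g p = freeSpace F X.g p' := by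
      ext c
      exact forall_congr' fun i => by rw [hp (X.g i) (by simp)]
    have hZ : X.relSpace q = X.relSpace q' := by
      have : {i | X.h i ≤ q} = {i | X.h i ≤ q'} := Set.ext fun i => hq (X.h i) (by simp)
      rw [Presentation.relSpace, this, Presentation.relSpace]
    rw [rank, rank, dif_pos hpq, dif_pos hpq', X.finrank_range_map, X.finrank_range_map, hA, hZ]
  · intro p hp
    have hA : freeSpace F X.g p = ⊥ := by
      rw [eq_bot_iff]
      intro c hc
      exact funext fun i => hc i (hp _ (by simp))
    rw [rank, dif_pos le_rfl, X.finrank_range_map, hA, Submodule.map_bot, finrank_bot]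

/-- All points of the diagram lie strictly above the diagonal. -/
def IsProper (D : Multiset DgmPoint) : Prop := ∀ p ∈ D, (p.1 : WithTop ℝ) < p.2

open Classical in
/-- The number of points of `D` born until `s` and alive at `t`. -/
noncomputable def aliveCount (D : Multiset DgmPoint) (s t : ℝ) : ℕ :=
  (D.filter fun p => p.1 ≤ s ∧ (t : WithTop ℝ) < p.2).card

/-- The multiset `D` is a diagram of ranks along the curve `γ`. -/
structure IsRankDiagram (R : ℝ × ℝ → ℝ × ℝ → ℕ) (γ : ℝ → ℝ × ℝ) (D : Multiset DgmPoint) :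
    Prop where
  proper : IsProper D
  aliveCount_eq : ∀ {s t : ℝ}, s ≤ t → aliveCount D s t = R (γ s) (γ t)

theorem PersistenceModule.IsFinitelyPresented.isRankDiagram {F : Type u} [Field F]
    {M : PersistenceModule.{u, v} F (ℝ × ℝ)} (hM : M.IsFinitelyPresented) (L : PosLine) :
    IsRankDiagram M.rank L.point (dgm (M.restrict L)) := by
  obtain ⟨X⟩ := hM.nonempty_presentation
  have hD := IsPersistenceDiagram.dgm (X.restrict L).exists_isPersistenceDiagram
  refine ⟨hD.1, fun hst => ?_⟩
  rw [aliveCount, hD.card_filter hst, rank, dif_pos (L.point_mono hst)]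
  rfl

/-! ### The bottleneck distance through matchings of padded diagrams -/

theorem deathDist_self (a : WithTop ℝ) : deathDist a a = 0 := by
  rcases a with _ | a
  · rfl
  · exact edist_self a

theorem deathDist_comm (a b : WithTop ℝ) : deathDist a b = deathDist b a := by
  rcases a with _ | a <;> rcases b with _ | b
  · rfl
  · rfl
  · rfl
  · exact edist_comm a b

theorem deathDist_triangle (a b c : WithTop ℝ) :
    deathDist a c ≤ deathDist a b + deathDist b c := by
  rcases a with _ | a <;> rcases b with _ | b <;> rcases c with _ | c <;>
    first
    | exact edist_triangle a b c
    | simp [deathDist]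

theorem pointDist_self (p : DgmPoint) : pointDist p p = 0 := by
  simp [pointDist, deathDist_self]

theorem pointDist_comm (p q : DgmPoint) : pointDist p q = pointDist q p := by
  rw [pointDist, pointDist, edist_comm, deathDist_comm]

theorem pointDist_triangle (p q r : DgmPoint) :
    pointDist p r ≤ pointDist p q + pointDist q r :=
  max_le ((edist_triangle _ _ _).trans (add_le_add (le_max_left _ _) (le_max_left _ _)))
    ((deathDist_triangle _ _ _).trans (add_le_add (le_max_right _ _) (le_max_right _ _)))

theorem diagDist_le_pointDist (p : DgmPoint) (x : ℝ) : diagDist p ≤ pointDist p (x, (x : ℝ)) := by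
  rcases p with ⟨b, _ | d⟩
  · exact le_max_right _ _
  · change ENNReal.ofReal ((d - b) / 2) ≤ max (edist b x) (edist d x)
    rw [edist_dist, edist_dist, ← ENNReal.ofReal_max, Real.dist_eq, Real.dist_eq]
    refine ENNReal.ofReal_le_ofReal ?_
    have h1 := neg_abs_le (b - x)
    have h2 := le_abs_self (d - x)
    have h3 := le_max_left |b - x| |d - x|
    have h4 := le_max_right |b - x| |d - x|
    linarith

theorem exists_pointDist_le_diagDist (p : DgmPoint) (hp : (p.1 : WithTop ℝ) < p.2) :
    ∃ x : ℝ, pointDist p (x, (x : ℝ)) ≤ diagDist p := by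
  rcases p with ⟨b, _ | d⟩
  · exact ⟨0, le_top⟩
  · have hbd : b < d := WithTop.coe_lt_coe.1 hp
    refine ⟨(b + d) / 2, ?_⟩
    change max (edist b _) (edist d _) ≤ ENNReal.ofReal ((d - b) / 2)
    rw [edist_dist, edist_dist, Real.dist_eq, Real.dist_eq]
    refine max_le (ENNReal.ofReal_le_ofReal ?_) (ENNReal.ofReal_le_ofReal ?_)
    · rw [abs_le]
      constructor <;> linarith
    · rw [abs_le]
      constructor <;> linarith

/-- After adding points of the diagonal, `D` and `E` can be matched completely within distance `c`.
In contrast to partial matchings, such complete matchings compose. -/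
def IsNear (c : ℝ≥0∞) (D E : Multiset DgmPoint) : Prop :=
  ∃ S T : Multiset DgmPoint, (∀ p ∈ S, p.2 = p.1) ∧ (∀ p ∈ T, p.2 = p.1) ∧
    Multiset.Rel (fun p q => pointDist p q ≤ c) (D + S) (E + T)

namespace IsNear

theorem symm {c : ℝ≥0∞} {D E : Multiset DgmPoint} (h : IsNear c D E) : IsNear c E D := by
  obtain ⟨S, T, hS, hT, h⟩ := h
  refine ⟨T, S, hT, hS, Multiset.rel_flip.1 ?_⟩
  exact h.mono fun p _ q _ hpq => by rwa [flip, pointDist_comm]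

theorem trans {c c' : ℝ≥0∞} {D E G : Multiset DgmPoint} (h : IsNear c D E)
    (h' : IsNear c' E G) : IsNear (c + c') D G := by
  obtain ⟨S, T, hS, hT, h⟩ := h
  obtain ⟨S', T', hS', hT', h'⟩ := h'
  have hrefl : ∀ (k : ℝ≥0∞) (A : Multiset DgmPoint),
      Multiset.Rel (fun p q => pointDist p q ≤ k) A A := fun k A =>
    Multiset.rel_refl_of_refl_on fun p _ => by simp [pointDist_self]
  have h1 := h.add (hrefl c S')
  have h2 := h'.add (hrefl c' T)
  rw [add_right_comm E S' T] at h2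
  refine ⟨S + S', T' + T, ?_, ?_, ?_⟩
  · intro p hp
    exact (Multiset.mem_add.1 hp).elim (hS p) (hS' p)
  · intro p hp
    exact (Multiset.mem_add.1 hp).elim (hT' p) (hT p)
  · rw [← add_assoc, ← add_assoc]
    have key : ∀ {A B C : Multiset DgmPoint},
        Multiset.Rel (fun p q => pointDist p q ≤ c) A B →
        Multiset.Rel (fun p q => pointDist p q ≤ c') B C →
        Multiset.Rel (fun p q => pointDist p q ≤ c + c') A C := by
      intro A B C hAB
      induction hAB generalizing C with
      | zero =>
        intro hBC
        rw [Multiset.rel_zero_left.1 hBC]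
        exact Multiset.Rel.zero
      | cons hab _ ih =>
        intro hBC
        obtain ⟨q, C', hq, hC', rfl⟩ := Multiset.rel_cons_left.1 hBC
        exact Multiset.Rel.cons ((pointDist_triangle _ _ _).trans (add_le_add hab hq)) (ih hC')
    exact key h1 h2

end IsNear

theorem Multiset.exists_refinement {α : Type*} {A B C D : Multiset α} (h : A + B = C + D) :
    ∃ a b c d, A = a + b ∧ B = c + d ∧ C = a + c ∧ D = b + d := by
  classical
  refine ⟨A ∩ C, A - C, C - A, D - (A - C), ?_, ?_, ?_, ?_⟩ <;>
  · ext x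
    have := congrArg (Multiset.count x) h
    simp only [Multiset.count_add, Multiset.count_sub, Multiset.count_inter] at this ⊢
    omega

theorem Multiset.Rel.exists_pairs {α β : Type*} {r : α → β → Prop} {A : Multiset α}
    {B : Multiset β} (h : Multiset.Rel r A B) :
    ∃ Q : Multiset (α × β), Q.map Prod.fst = A ∧ Q.map Prod.snd = B ∧ ∀ x ∈ Q, r x.1 x.2 := by
  induction h with
  | zero => exact ⟨0, rfl, rfl, by simp⟩
  | @cons a b _ _ hab _ ih =>
    obtain ⟨Q, rfl, rfl, hQ⟩ := ih
    refine ⟨(a, b) ::ₘ Q, by simp, by simp, fun x hx => ?_⟩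
    rcases Multiset.mem_cons.1 hx with rfl | hx
    · exact hab
    · exact hQ x hx

theorem IsNear.bottleneckDist_le {c : ℝ≥0∞} {D E : Multiset DgmPoint} (h : IsNear c D E) :
    bottleneckDist D E ≤ c := by
  obtain ⟨S, T, hS, hT, h⟩ := h
  obtain ⟨E₁, E₂, hD, hSE, hE⟩ := Multiset.rel_add_left.1 h
  obtain ⟨e, e', t, t', rfl, rfl, rfl, rfl⟩ := Multiset.exists_refinement hE
  obtain ⟨d, d', hd, hd', rfl⟩ := Multiset.rel_add_right.1 hD
  obtain ⟨Q, rfl, rfl, hQ⟩ := hd.exists_pairs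
  have hdiag : ∀ p q : DgmPoint, q.2 = q.1 → pointDist p q ≤ c → diagDist p ≤ c := by
    rintro p ⟨x, d⟩ hd hpq
    obtain rfl : d = x := hd
    exact (diagDist_le_pointDist p x).trans hpq
  refine iInf_le_of_le ⟨Q, d', e', rfl, rfl⟩ (max_le ?_ ?_)
  · rw [Multiset.sup_le]
    intro x hx
    obtain ⟨y, hy, rfl⟩ := Multiset.mem_map.1 hx
    exact hQ y hy
  · rw [Multiset.sup_le]
    intro x hx
    obtain ⟨p, hp, rfl⟩ := Multiset.mem_map.1 hx
    rcases Multiset.mem_add.1 hp with hp | hp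
    · obtain ⟨q, hq, hpq⟩ := Multiset.exists_mem_of_rel_of_mem hd' hp
      exact hdiag p q (hT q (Multiset.mem_add.2 (Or.inl hq))) hpq
    · obtain ⟨q, hq, hpq⟩ := Multiset.exists_mem_of_rel_of_mem (Multiset.rel_flip.2 hSE)
        (Multiset.mem_add.2 (Or.inl hp))
      exact hdiag p q (hS q hq) (by rw [pointDist_comm]; exact hpq)

theorem DgmMatching.pointDist_le_cost {D E : Multiset DgmPoint} (σ : DgmMatching D E)
    {x : DgmPoint × DgmPoint} (hx : x ∈ σ.pairs) : pointDist x.1 x.2 ≤ σ.cost := by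
  have h : pointDist x.1 x.2 ∈ σ.pairs.map fun x => pointDist x.1 x.2 :=
    Multiset.mem_map.2 ⟨x, hx, rfl⟩
  exact (Multiset.le_sup h).trans (le_max_left _ _)

theorem DgmMatching.diagDist_le_cost {D E : Multiset DgmPoint} (σ : DgmMatching D E)
    {p : DgmPoint} (hp : p ∈ σ.unmatchedLeft + σ.unmatchedRight) : diagDist p ≤ σ.cost := by
  have h : diagDist p ∈ (σ.unmatchedLeft + σ.unmatchedRight).map diagDist :=
    Multiset.mem_map.2 ⟨p, hp, rfl⟩
  exact (Multiset.le_sup h).trans (le_max_right _ _)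

theorem DgmMatching.isNear {D E : Multiset DgmPoint} (σ : DgmMatching D E) (hD : IsProper D)
    (hE : IsProper E) : IsNear σ.cost D E := by
  have hunm : ∀ p ∈ σ.unmatchedLeft + σ.unmatchedRight, ∃ x : ℝ,
      pointDist p (x, (x : ℝ)) ≤ σ.cost := by
    intro p hp
    have hproper : (p.1 : WithTop ℝ) < p.2 := by
      rcases Multiset.mem_add.1 hp with hp | hp
      · exact hD p (by rw [← σ.left_eq]; exact Multiset.mem_add.2 (Or.inr hp))
      · exact hE p (by rw [← σ.right_eq]; exact Multiset.mem_add.2 (Or.inr hp))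
    obtain ⟨x, hx⟩ := exists_pointDist_le_diagDist p hproper
    exact ⟨x, hx.trans (σ.diagDist_le_cost hp)⟩
  choose! z hz using hunm
  have hrel : ∀ A ≤ σ.unmatchedLeft + σ.unmatchedRight,
      Multiset.Rel (fun p q => pointDist p q ≤ σ.cost) A
        (A.map fun p => (z p, ((z p : ℝ) : WithTop ℝ))) := by
    intro A hA
    rw [Multiset.rel_map_right]
    exact Multiset.rel_refl_of_refl_on fun p hp => hz p (Multiset.mem_of_le hA hp)
  have hpairs : Multiset.Rel (fun p q => pointDist p q ≤ σ.cost) (σ.pairs.map Prod.fst)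
      (σ.pairs.map Prod.snd) := by
    rw [Multiset.rel_map]
    exact Multiset.rel_refl_of_refl_on fun x hx => σ.pointDist_le_cost hx
  have hL := hrel _ (Multiset.le_add_right σ.unmatchedLeft σ.unmatchedRight)
  have hR : Multiset.Rel (fun p q => pointDist p q ≤ σ.cost)
      (σ.unmatchedRight.map fun p => (z p, ((z p : ℝ) : WithTop ℝ))) σ.unmatchedRight :=
    (Multiset.rel_flip.2 (hrel _ (Multiset.le_add_left σ.unmatchedRight σ.unmatchedLeft))).mono
      fun p _ q _ hpq => by rwa [flip, pointDist_comm] at hpq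
  refine ⟨σ.unmatchedRight.map fun p => (z p, ((z p : ℝ) : WithTop ℝ)),
    σ.unmatchedLeft.map fun p => (z p, ((z p : ℝ) : WithTop ℝ)), ?_, ?_, ?_⟩
  · intro p hp
    obtain ⟨q, -, rfl⟩ := Multiset.mem_map.1 hp
    rfl
  · intro p hp
    obtain ⟨q, -, rfl⟩ := Multiset.mem_map.1 hp
    rfl
  · have h := (hpairs.add hL).add hR
    rwa [σ.left_eq, add_right_comm, σ.right_eq] at h

theorem bottleneckDist_triangle {D E G : Multiset DgmPoint} (hD : IsProper D) (hE : IsProper E)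
    (hG : IsProper G) : bottleneckDist D G ≤ bottleneckDist D E + bottleneckDist E G :=
  ENNReal.le_iInf_add_iInf fun σ τ => ((σ.isNear hD hE).trans (τ.isNear hE hG)).bottleneckDist_le

/-! ### Rescaling diagrams -/

/-- Rescaling of the half plane by `m` around the centre `c`. -/
noncomputable def rescale (m c : ℝ) (p : DgmPoint) : DgmPoint :=
  (m * (p.1 - c), p.2.map fun x => m * (x - c))

theorem pointDist_rescale {m : ℝ} (hm : 0 < m) (c : ℝ) (p q : DgmPoint) :
    pointDist (rescale m c p) (rescale m c q) = ENNReal.ofReal m * pointDist p q := by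
  have h : ∀ a b : ℝ, edist (m * (a - c)) (m * (b - c)) = ENNReal.ofReal m * edist a b := by
    intro a b
    rw [edist_dist, edist_dist, ← ENNReal.ofReal_mul hm.le, Real.dist_eq, Real.dist_eq,
      ← mul_sub, abs_mul, abs_of_pos hm]
    congr 3
    ring
  have hm' : ENNReal.ofReal m * ⊤ = ⊤ := ENNReal.mul_top (ENNReal.ofReal_pos.2 hm).ne'
  have hd : ∀ a b : WithTop ℝ, deathDist (a.map fun x => m * (x - c))
      (b.map fun x => m * (x - c)) = ENNReal.ofReal m * deathDist a b := by
    intro a b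
    rcases a with _ | a <;> rcases b with _ | b
    · exact (mul_zero _).symm
    · exact hm'.symm
    · exact hm'.symm
    · exact h a b
  rw [pointDist, pointDist, mul_max, ← hd, ← h]
  rfl

theorem rescale_inv_rescale {m : ℝ} (hm : 0 < m) (c : ℝ) (p : DgmPoint) :
    rescale m⁻¹ (-(m * c)) (rescale m c p) = p := by
  have h : ∀ a : ℝ, m⁻¹ * (m * (a - c) - -(m * c)) = a := by
    intro a
    field_simp
    ring
  rcases p with ⟨b, _ | d⟩
  · exact Prod.ext (h b) rfl
  · exact Prod.ext (h b) (congrArg WithTop.some (h d))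

theorem IsProper.rescale {m : ℝ} (hm : 0 < m) (c : ℝ) {D : Multiset DgmPoint} (hD : IsProper D) :
    IsProper (D.map (rescale m c)) := by
  intro p hp
  obtain ⟨⟨b, _ | d⟩, hq, rfl⟩ := Multiset.mem_map.1 hp
  · exact WithTop.coe_lt_top _
  · refine WithTop.coe_lt_coe.2 (mul_lt_mul_of_pos_left ?_ hm)
    exact sub_lt_sub_right (WithTop.coe_lt_coe.1 (hD _ hq)) c

theorem bottleneckDist_rescale_le {m : ℝ} (hm : 0 < m) (c : ℝ) {D E : Multiset DgmPoint}
    (hD : IsProper D) (hE : IsProper E) :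
    bottleneckDist (D.map (rescale m c)) (E.map (rescale m c)) ≤
      ENNReal.ofReal m * bottleneckDist D E := by
  rw [bottleneckDist, bottleneckDist, ENNReal.mul_iInf_of_ne (ENNReal.ofReal_pos.2 hm).ne'
    ENNReal.ofReal_ne_top]
  refine le_iInf fun σ => ?_
  obtain ⟨S, T, hS, hT, h⟩ := σ.isNear hD hE
  have hdiag : ∀ A : Multiset DgmPoint, (∀ p ∈ A, p.2 = p.1) →
      ∀ p ∈ A.map (rescale m c), p.2 = p.1 := by
    intro A hA p hp
    obtain ⟨q, hq, rfl⟩ := Multiset.mem_map.1 hp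
    simp [rescale, hA q hq]
  refine IsNear.bottleneckDist_le ⟨S.map (rescale m c), T.map (rescale m c), hdiag S hS,
    hdiag T hT, ?_⟩
  rw [← Multiset.map_add, ← Multiset.map_add, Multiset.rel_map]
  refine h.mono fun p _ q _ hpq => ?_
  rw [pointDist_rescale hm]
  gcongr

theorem bottleneckDist_rescale {m : ℝ} (hm : 0 < m) (c : ℝ) {D E : Multiset DgmPoint}
    (hD : IsProper D) (hE : IsProper E) :
    bottleneckDist (D.map (rescale m c)) (E.map (rescale m c)) =
      ENNReal.ofReal m * bottleneckDist D E := by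
  refine le_antisymm (bottleneckDist_rescale_le hm c hD hE) ?_
  have h := bottleneckDist_rescale_le (inv_pos.2 hm) (-(m * c)) (hD.rescale hm c) (hE.rescale hm c)
  simp only [Multiset.map_map, Function.comp_def, rescale_inv_rescale hm, Multiset.map_id'] at h
  calc ENNReal.ofReal m * bottleneckDist D E
      ≤ ENNReal.ofReal m * (ENNReal.ofReal m⁻¹ * _) := by gcongr
    _ = _ := by
      rw [← mul_assoc, ← ENNReal.ofReal_mul hm.le, mul_inv_cancel₀ hm.ne', ENNReal.ofReal_one,
        one_mul]

/-! ### Finiteness of the bottleneck distance -/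

open Classical in
/-- The number of points that never die. -/
noncomputable def topCount (D : Multiset DgmPoint) : ℕ := D.countP fun p => p.2 = ⊤

theorem topCount_eq_of_bottleneckDist_ne_top {D E : Multiset DgmPoint}
    (h : bottleneckDist D E ≠ ⊤) : topCount D = topCount E := by
  classical
  obtain ⟨σ, hσ⟩ : ∃ σ : DgmMatching D E, σ.cost ≠ ⊤ := by
    by_contra! hcon
    exact h (iInf_eq_top.2 hcon)
  have hpair : ∀ x ∈ σ.pairs, x.1.2 = ⊤ ↔ x.2.2 = ⊤ := by
    rintro ⟨⟨a, d⟩, ⟨b, d'⟩⟩ hx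
    have h1 : deathDist d d' ≠ ⊤ := ne_top_of_le_ne_top hσ
      ((le_max_right _ _).trans (σ.pointDist_le_cost hx))
    rcases d with _ | d <;> rcases d' with _ | d'
    · exact Iff.rfl
    · exact absurd rfl h1
    · exact absurd rfl h1
    · exact iff_of_false WithTop.coe_ne_top WithTop.coe_ne_top
  have hunm : ∀ p ∈ σ.unmatchedLeft + σ.unmatchedRight, ¬ p.2 = ⊤ := by
    rintro ⟨b, d⟩ hp hd
    obtain rfl : d = ⊤ := hd
    exact hσ (top_unique (σ.diagDist_le_cost hp))
  have hL : topCount D = σ.pairs.countP fun x => x.1.2 = ⊤ := by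
    rw [topCount]
    conv_lhs => rw [← σ.left_eq]
    rw [Multiset.countP_add, Multiset.countP_map, ← Multiset.countP_eq_card_filter,
      Multiset.countP_eq_zero.2 fun p hp => hunm p (Multiset.mem_add.2 (Or.inl hp)), add_zero]
  have hR : topCount E = σ.pairs.countP fun x => x.2.2 = ⊤ := by
    rw [topCount]
    conv_lhs => rw [← σ.right_eq]
    rw [Multiset.countP_add, Multiset.countP_map, ← Multiset.countP_eq_card_filter,
      Multiset.countP_eq_zero.2 fun p hp => hunm p (Multiset.mem_add.2 (Or.inr hp)), add_zero]
  rw [hL, hR]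
  exact Multiset.countP_congr rfl fun x hx => by simpa using hpair x hx

theorem bottleneckDist_ne_top_of_topCount_eq {D E : Multiset DgmPoint}
    (h : topCount D = topCount E) : bottleneckDist D E ≠ ⊤ := by
  classical
  have hsup : ∀ A : Multiset ℝ≥0∞, (∀ x ∈ A, x < ⊤) → A.sup < ⊤ := by
    intro A
    induction A using Multiset.induction_on with
    | empty => simp
    | cons a A ih =>
      intro hA
      rw [Multiset.sup_cons]
      exact max_lt (hA a (by simp)) (ih fun x hx => hA x (by simp [hx]))
  have hrel : Multiset.Rel (fun p q : DgmPoint => p.2 = ⊤ ∧ q.2 = ⊤)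
      (D.filter fun p => p.2 = ⊤) (E.filter fun p => p.2 = ⊤) := by
    refine Multiset.rel_of_forall (fun p q hp hq =>
      ⟨(Multiset.mem_filter.1 hp).2, (Multiset.mem_filter.1 hq).2⟩) ?_
    rw [← Multiset.countP_eq_card_filter, ← Multiset.countP_eq_card_filter]
    exact h
  obtain ⟨Q, hQ₁, hQ₂, hQ⟩ := hrel.exists_pairs
  let σ : DgmMatching D E := ⟨Q, D.filter fun p => ¬ p.2 = ⊤, E.filter fun p => ¬ p.2 = ⊤,
    by rw [hQ₁, Multiset.filter_add_not], by rw [hQ₂, Multiset.filter_add_not]⟩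
  refine ne_top_of_le_ne_top (b := σ.cost) ?_ (iInf_le _ σ)
  refine (max_lt (hsup _ ?_) (hsup _ ?_)).ne
  · intro x hx
    obtain ⟨⟨⟨a, d⟩, ⟨b, d'⟩⟩, hxQ, rfl⟩ := Multiset.mem_map.1 hx
    have hdd : d = ⊤ ∧ d' = ⊤ := hQ _ hxQ
    obtain ⟨rfl, rfl⟩ := hdd
    exact max_lt (edist_lt_top a b) (by rw [deathDist_self]; exact ENNReal.zero_lt_top)
  · intro x hx
    obtain ⟨⟨b, d⟩, hp, rfl⟩ := Multiset.mem_map.1 hx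
    have hd : d ≠ ⊤ := by
      rcases Multiset.mem_add.1 hp with hp | hp <;> exact (Multiset.mem_filter.1 hp).2
    lift d to ℝ using hd
    exact ENNReal.ofReal_lt_top

/-! ### Diagrams are determined by their ranks -/

theorem aliveCount_pos {D : Multiset DgmPoint} {s t : ℝ} :
    0 < aliveCount D s t ↔ ∃ p ∈ D, p.1 ≤ s ∧ (t : WithTop ℝ) < p.2 := by
  simp [aliveCount, Multiset.card_pos_iff_exists_mem]

theorem aliveCount_cons (p : DgmPoint) (D : Multiset DgmPoint) (s t : ℝ) :
    aliveCount (p ::ₘ D) s t = aliveCount {p} s t + aliveCount D s t := by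
  rw [aliveCount, aliveCount, aliveCount, ← Multiset.singleton_add, Multiset.filter_add,
    Multiset.card_add]

theorem exists_between_deaths {b : ℝ} {d : WithTop ℝ} (hbd : (b : WithTop ℝ) < d)
    (D : Multiset DgmPoint) :
    ∃ t : ℝ, b ≤ t ∧ (t : WithTop ℝ) < d ∧ ∀ q ∈ D, (t : WithTop ℝ) < q.2 → d ≤ q.2 := by
  induction D using Multiset.induction_on with
  | empty => exact ⟨b, le_rfl, hbd, by simp⟩
  | cons p D ih =>
    obtain ⟨t, hbt, htd, ht⟩ := ih
    by_cases hp : p.2 < d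
    · obtain ⟨x, hx⟩ := WithTop.ne_top_iff_exists.1 hp.ne_top
      refine ⟨max t x, hbt.trans (le_max_left _ _), ?_, fun q hq hlt => ?_⟩
      · rw [WithTop.coe_max]
        exact max_lt htd (hx ▸ hp)
      · rw [WithTop.coe_max, max_lt_iff] at hlt
        rcases Multiset.mem_cons.1 hq with rfl | hq
        · exact absurd hlt.2 (by rw [hx]; exact lt_irrefl _)
        · exact ht q hq hlt.1
    · refine ⟨t, hbt, htd, fun q hq hlt => ?_⟩
      rcases Multiset.mem_cons.1 hq with rfl | hq
      · exact not_lt.1 hp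
      · exact ht q hq hlt

/-- A point of `D` that is born first and, among these, dies last compared with the points of `D'`
is detected by the ranks. -/
theorem mem_of_aliveCount_eq {D D' : Multiset DgmPoint} {p : DgmPoint} (hp : p ∈ D)
    (hproper : (p.1 : WithTop ℝ) < p.2)
    (h : ∀ t, p.1 ≤ t → aliveCount D p.1 t = aliveCount D' p.1 t)
    (hmin : ∀ q ∈ D', p.1 ≤ q.1) (hmax : ∀ q ∈ D', q.1 = p.1 → q.2 ≤ p.2) : p ∈ D' := by
  obtain ⟨t, hbt, htd, ht⟩ := exists_between_deaths hproper D'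
  have hpos : 0 < aliveCount D p.1 t := aliveCount_pos.2 ⟨p, hp, le_rfl, htd⟩
  rw [h t hbt] at hpos
  obtain ⟨q, hq, hq1, hq2⟩ := aliveCount_pos.1 hpos
  have h1 : q.1 = p.1 := le_antisymm hq1 (hmin q hq)
  have h2 : q.2 = p.2 := le_antisymm (hmax q hq h1) (ht q hq hq2)
  exact (Prod.ext h1 h2 : q = p) ▸ hq

/-- A point that is born first in `D + D'` and, among these, dies last lies in both diagrams, and
can be removed. -/
theorem eq_of_aliveCount_eq {D D' : Multiset DgmPoint} (hD : IsProper D) (hD' : IsProper D')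
    (h0 : ∀ p ∈ D, 0 ≤ p.1) (h0' : ∀ p ∈ D', 0 ≤ p.1)
    (h : ∀ s t, 0 ≤ s → s ≤ t → aliveCount D s t = aliveCount D' s t) : D = D' := by
  classical
  induction hn : (D + D').card using Nat.strong_induction_on generalizing D D' with
  | _ n ih =>
  by_cases hne : D + D' = 0
  · obtain ⟨rfl, rfl⟩ := add_eq_zero.1 hne
    rfl
  obtain ⟨p₁, hp₁, hmin⟩ := Finset.exists_min_image (D + D').toFinset Prod.fst
    (by simpa [Finset.nonempty_iff_ne_empty] using hne)
  obtain ⟨p, hp, hmax⟩ := Finset.exists_max_image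
    ((D + D').toFinset.filter fun q => q.1 = p₁.1) Prod.snd
    ⟨p₁, Finset.mem_filter.2 ⟨hp₁, rfl⟩⟩
  obtain ⟨hpmem, hpp₁⟩ := Finset.mem_filter.1 hp
  rw [Multiset.mem_toFinset] at hpmem
  have hmin' : ∀ q ∈ D + D', p.1 ≤ q.1 := fun q hq => by
    rw [hpp₁]
    exact hmin q (Multiset.mem_toFinset.2 hq)
  have hmax' : ∀ q ∈ D + D', q.1 = p.1 → q.2 ≤ p.2 := fun q hq hqp =>
    hmax q (Finset.mem_filter.2 ⟨Multiset.mem_toFinset.2 hq, hqp.trans hpp₁⟩)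
  have hboth : p ∈ D ∧ p ∈ D' := by
    rcases Multiset.mem_add.1 hpmem with hp | hp
    · exact ⟨hp, mem_of_aliveCount_eq hp (hD p hp) (fun t ht => h _ t (h0 p hp) ht)
        (fun q hq => hmin' q (Multiset.mem_add.2 (Or.inr hq)))
        (fun q hq => hmax' q (Multiset.mem_add.2 (Or.inr hq)))⟩
    · exact ⟨mem_of_aliveCount_eq hp (hD' p hp) (fun t ht => (h _ t (h0' p hp) ht).symm)
        (fun q hq => hmin' q (Multiset.mem_add.2 (Or.inl hq)))
        (fun q hq => hmax' q (Multiset.mem_add.2 (Or.inl hq))), hp⟩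
  obtain ⟨A, rfl⟩ := Multiset.exists_cons_of_mem hboth.1
  obtain ⟨A', rfl⟩ := Multiset.exists_cons_of_mem hboth.2
  congr 1
  refine ih _ ?_ (fun q hq => hD q (Multiset.mem_cons_of_mem hq))
    (fun q hq => hD' q (Multiset.mem_cons_of_mem hq))
    (fun q hq => h0 q (Multiset.mem_cons_of_mem hq))
    (fun q hq => h0' q (Multiset.mem_cons_of_mem hq)) (fun s t hs hst => ?_) rfl
  · rw [← hn]
    simp only [Multiset.card_add, Multiset.card_cons]
    omega
  · have := h s t hs hst
    rw [aliveCount_cons, aliveCount_cons] at this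
    exact Nat.add_left_cancel this

/-! ### Collapsing a neighbourhood of zero -/

/-- The monotone map that moves everything up to `k` to `0`. -/
noncomputable def clip (k a : ℝ) : ℝ := if a ≤ k then 0 else a

theorem clip_le_iff {k s : ℝ} (hs : 0 ≤ s) (a : ℝ) : clip k a ≤ s ↔ a ≤ max k s := by
  unfold clip
  split_ifs with h
  · exact iff_of_true hs (h.trans (le_max_left _ _))
  · rw [le_max_iff]
    exact ⟨Or.inr, fun h' => h'.resolve_left h⟩

theorem clip_nonneg {k : ℝ} (hk : 0 ≤ k) (a : ℝ) : 0 ≤ clip k a := by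
  unfold clip
  split_ifs with h
  · exact le_rfl
  · linarith

theorem clip_mono {k : ℝ} (hk : 0 ≤ k) : Monotone (clip k) := by
  intro a b hab
  rw [clip_le_iff (clip_nonneg hk b)]
  unfold clip
  split_ifs with h
  · exact hab.trans (h.trans (le_max_left _ _))
  · exact hab.trans (le_max_right _ _)

theorem edist_clip_le {k a : ℝ} (hk : 0 ≤ k) (ha : -k ≤ a) :
    edist a (clip k a) ≤ ENNReal.ofReal k := by
  rw [edist_dist, Real.dist_eq]
  refine ENNReal.ofReal_le_ofReal ?_
  unfold clip
  split_ifs with h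
  · rw [sub_zero, abs_le]
    exact ⟨ha, h⟩
  · rwa [sub_self, abs_zero]

/-- The map `clip k` on both coordinates. -/
noncomputable def clipPoint (k : ℝ) (p : DgmPoint) : DgmPoint := (clip k p.1, p.2.map (clip k))

open Classical in
/-- The diagram with all coordinates moved by `clip k`, without the points that reach the
diagonal. -/
noncomputable def clipDgm (k : ℝ) (D : Multiset DgmPoint) : Multiset DgmPoint :=
  (D.map (clipPoint k)).filter fun p => (p.1 : WithTop ℝ) < p.2

theorem isProper_clipDgm (k : ℝ) (D : Multiset DgmPoint) : IsProper (clipDgm k D) :=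
  fun _ hp => (Multiset.mem_filter.1 hp).2

theorem clipDgm_nonneg {k : ℝ} (hk : 0 ≤ k) (D : Multiset DgmPoint) :
    ∀ p ∈ clipDgm k D, 0 ≤ p.1 := by
  intro p hp
  obtain ⟨q, -, rfl⟩ := Multiset.mem_map.1 (Multiset.mem_filter.1 hp).1
  exact clip_nonneg hk _

/-- The points that reach the diagonal serve as the padding of the collapsed diagram. -/
theorem isNear_clipDgm {k : ℝ} (hk : 0 ≤ k) {D : Multiset DgmPoint} (hD : IsProper D)
    (hbirth : ∀ p ∈ D, -k ≤ p.1) : IsNear (ENNReal.ofReal k) D (clipDgm k D) := by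
  classical
  refine ⟨0, (D.map (clipPoint k)).filter fun p => ¬ (p.1 : WithTop ℝ) < p.2, by simp, ?_, ?_⟩
  · intro p hp
    obtain ⟨hp, hlt⟩ := Multiset.mem_filter.1 hp
    obtain ⟨⟨b, _ | d⟩, hq, rfl⟩ := Multiset.mem_map.1 hp
    · exact absurd (WithTop.coe_lt_top _) hlt
    · refine le_antisymm (not_lt.1 hlt) (WithTop.coe_le_coe.2 (clip_mono hk ?_))
      exact (WithTop.coe_lt_coe.1 (hD _ hq)).le
  · rw [clipDgm, Multiset.filter_add_not, add_zero, Multiset.rel_map_right]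
    refine Multiset.rel_refl_of_refl_on ?_
    rintro ⟨b, _ | d⟩ hp
    · exact max_le (edist_clip_le hk (hbirth _ hp)) bot_le
    · exact max_le (edist_clip_le hk (hbirth _ hp))
        (edist_clip_le hk ((hbirth _ hp).trans (WithTop.coe_lt_coe.1 (hD _ hp)).le))

theorem clip_rescale_le_iff {k m : ℝ} (hm : 0 < m) (c : ℝ) {s : ℝ} (hs : 0 ≤ s) (b : ℝ) :
    clip k (m * (b - c)) ≤ s ↔ b ≤ c + max k s / m := by
  rw [clip_le_iff hs, ← sub_le_iff_le_add', le_div_iff₀' hm]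

theorem aliveCount_clipDgm {k m : ℝ} (hm : 0 < m) (c : ℝ) (D : Multiset DgmPoint) {s t : ℝ}
    (hs : 0 ≤ s) (hst : s ≤ t) :
    aliveCount (clipDgm k (D.map (rescale m c))) s t =
      aliveCount D (c + max k s / m) (c + max k t / m) := by
  classical
  rw [aliveCount, aliveCount, clipDgm, Multiset.filter_filter, Multiset.map_map,
    Multiset.filter_map, Multiset.card_map]
  congr 1
  refine Multiset.filter_congr fun p _ => ?_
  have h1 : (clipPoint k (rescale m c p)).1 ≤ s ↔ p.1 ≤ c + max k s / m :=
    clip_rescale_le_iff hm c hs p.1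
  have h2 : (t : WithTop ℝ) < (clipPoint k (rescale m c p)).2 ↔
      ((c + max k t / m : ℝ) : WithTop ℝ) < p.2 := by
    rcases p with ⟨b, _ | d⟩
    · exact iff_of_true (WithTop.coe_lt_top _) (WithTop.coe_lt_top _)
    · refine WithTop.coe_lt_coe.trans (Iff.trans ?_ WithTop.coe_lt_coe.symm)
      rw [← not_le, ← not_le]
      exact not_congr (clip_rescale_le_iff hm c (hs.trans hst) d)
  rw [← h1, ← h2]
  refine ⟨And.left, fun h => ⟨h, ?_⟩⟩
  exact (WithTop.coe_le_coe.2 (h.1.trans hst)).trans_lt h.2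

/-! ### The limit along steep lines -/

/-- `D` is the diagram on the half line `[0, ∞)` of the ranks along the horizontal ray that starts
at `(x, y)`. -/
structure IsRayDiagram (R : ℝ × ℝ → ℝ × ℝ → ℕ) (x y : ℝ) (D : Multiset DgmPoint) : Prop where
  proper : IsProper D
  nonneg : ∀ p ∈ D, 0 ≤ p.1
  aliveCount_eq : ∀ s t, 0 ≤ s → s ≤ t → aliveCount D s t = R (x + s, y) (x + t, y)

theorem IsRayDiagram.unique {R : ℝ × ℝ → ℝ × ℝ → ℕ} {x y : ℝ} {D D' : Multiset DgmPoint}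
    (h : IsRayDiagram R x y D) (h' : IsRayDiagram R x y D') : D = D' :=
  eq_of_aliveCount_eq h.proper h'.proper h.nonneg h'.nonneg fun s t hs hst =>
    (h.aliveCount_eq s t hs hst).trans (h'.aliveCount_eq s t hs hst).symm

/-- On the line `s ↦ (x, y) + (s - c) (m, 1)` the ranks vanish for `s < c - K`, and from `s = c + K`
on the line runs above all grades. After rescaling, the births and deaths in between lie in
`[-m K, m K]`; once `m` is so small that no grade has its first coordinate in `(x, x + m K]`,
collapsing that interval to `0` leaves the ranks along the ray above all grades. -/
theorem IsGradedRank.exists_isRayDiagram {R : ℝ × ℝ → ℝ × ℝ → ℕ} {S : Finset (ℝ × ℝ)}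
    (hR : IsGradedRank R S) (x y : ℝ) {Y : ℝ} (hY : ∀ g ∈ S, g.2 ≤ Y) :
    ∃ K : ℝ, ∀ᶠ m in 𝓝[>] (0 : ℝ), ∀ (c : ℝ) (D : Multiset DgmPoint),
      IsRankDiagram R (fun s => (x + m * (s - c), y + (s - c))) D →
      ∃ D', IsRayDiagram R x Y D' ∧ IsNear (ENNReal.ofReal (m * K)) (D.map (rescale m c)) D' := by
  obtain ⟨Z, hZ⟩ : ∃ Z, ∀ g ∈ S, Z ≤ g.2 := by
    obtain ⟨Z, hZ⟩ := (S.image Prod.snd).bddBelow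
    exact ⟨Z, fun g hg => hZ (Finset.mem_coe.2 (Finset.mem_image_of_mem _ hg))⟩
  obtain ⟨K, hK0, hKY, hKZ⟩ : ∃ K : ℝ, 0 ≤ K ∧ Y ≤ y + K ∧ y - K ≤ Z :=
    ⟨|Y - y| + |Z - y|, by positivity,
      by linarith [le_abs_self (Y - y), abs_nonneg (Z - y)],
      by linarith [neg_abs_le (Z - y), abs_nonneg (Y - y)]⟩
  -- the first coordinates of the grades beyond `x` stay beyond `x + m K`
  have hgap : ∀ᶠ m in 𝓝[>] (0 : ℝ), ∀ g ∈ S, x < g.1 → x + m * K < g.1 := by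
    rw [Finset.eventually_all]
    intro g _
    by_cases hg : x < g.1
    · have hlim : Filter.Tendsto (fun m : ℝ => x + m * K) (𝓝[>] 0) (𝓝 x) := by
        have h : Filter.Tendsto (fun m : ℝ => x + m * K) (𝓝 0) (𝓝 (x + 0 * K)) :=
          Continuous.tendsto (by fun_prop) 0
        rw [zero_mul, add_zero] at h
        exact h.mono_left nhdsWithin_le_nhds
      filter_upwards [hlim.eventually_lt_const hg] with m hm _ using hm
    · exact Filter.Eventually.of_forall fun m h => absurd h hg
  refine ⟨K, ?_⟩
  filter_upwards [hgap, self_mem_nhdsWithin] with m hgap hm c D hD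
  have hm : 0 < m := hm
  have hk : 0 ≤ m * K := mul_nonneg hm.le hK0
  refine ⟨clipDgm (m * K) (D.map (rescale m c)), ⟨isProper_clipDgm _ _, clipDgm_nonneg hk _, ?_⟩,
    isNear_clipDgm hk (hD.proper.rescale hm c) ?_⟩
  · intro s t hs hst
    have hmono : max (m * K) s / m ≤ max (m * K) t / m := by gcongr
    rw [aliveCount_clipDgm hm c D hs hst, hD.aliveCount_eq (by linarith)]
    have hgrade : ∀ s, 0 ≤ s → ∀ g ∈ S,
        g ≤ (x + m * (c + max (m * K) s / m - c), y + (c + max (m * K) s / m - c)) ↔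
          g ≤ (x + s, Y) := by
      intro s hs g hg
      have h1 : m * (c + max (m * K) s / m - c) = max (m * K) s := by
        field_simp
        ring
      have h2 : K ≤ c + max (m * K) s / m - c := by
        rw [add_sub_cancel_left, le_div_iff₀' hm]
        exact le_max_left _ _
      rw [h1, Prod.le_def, Prod.le_def]
      refine and_congr
        ⟨fun h => ?_, fun h => h.trans (by dsimp only; gcongr; exact le_max_right _ _)⟩
        (iff_of_true ((hY g hg).trans (by dsimp only; linarith)) (hY g hg))
      by_contra hcon
      dsimp only at h hcon
      rcases le_total (m * K) s with hle | hle
      · rw [max_eq_right hle] at h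
        exact hcon h
      · rw [max_eq_left hle] at h
        exact absurd h (hgap g hg (by linarith)).not_ge
    refine hR.congr ?_ ?_ (hgrade s hs) (hgrade t (hs.trans hst))
    · exact ⟨by dsimp only; gcongr, by dsimp only; gcongr⟩
    · exact ⟨by dsimp only; gcongr, le_rfl⟩
  -- at the birth of a point the rank is positive, hence some grade lies below
  · intro p hp
    obtain ⟨q, hq, rfl⟩ := Multiset.mem_map.1 hp
    have hpos : 0 < aliveCount D q.1 q.1 := aliveCount_pos.2 ⟨q, hq, le_rfl, hD.proper q hq⟩
    rw [hD.aliveCount_eq le_rfl] at hpos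
    obtain ⟨g, hg, hgq⟩ : ∃ g ∈ S, g ≤ (x + m * (q.1 - c), y + (q.1 - c)) := by
      by_contra! hcon
      exact hpos.ne' (hR.self_eq_zero _ hcon)
    have h1 : g.2 ≤ y + (q.1 - c) := hgq.2
    have h2 : -K ≤ q.1 - c := by linarith [hZ g hg]
    calc -(m * K) = m * (-K) := by ring
      _ ≤ m * (q.1 - c) := by gcongr

instance zeroPlus_neBot : zeroPlus.NeBot := by
  refine Filter.NeBot.comap_of_range_mem inferInstance ?_
  rw [Subtype.range_coe]
  exact Ioo_mem_nhdsGT one_pos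

theorem tendsto_ofReal_mul_zeroPlus (K : ℝ) :
    Filter.Tendsto (fun m : Set.Ioo (0 : ℝ) 1 => ENNReal.ofReal (m * K)) zeroPlus (𝓝 0) := by
  have h : Filter.Tendsto (fun m : ℝ => ENNReal.ofReal (m * K)) (𝓝 0)
      (𝓝 (ENNReal.ofReal (0 * K))) :=
    ENNReal.tendsto_ofReal (Continuous.tendsto (by fun_prop) 0)
  rw [zero_mul, ENNReal.ofReal_zero] at h
  exact (h.mono_left nhdsWithin_le_nhds).comp Filter.tendsto_comap

theorem ENNReal.tendsto_of_le_add {α : Type*} {l : Filter α} {f e : α → ℝ≥0∞} {a : ℝ≥0∞}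
    (he : Filter.Tendsto e l (𝓝 0)) (h₁ : ∀ᶠ x in l, f x ≤ a + e x)
    (h₂ : ∀ᶠ x in l, a ≤ f x + e x) : Filter.Tendsto f l (𝓝 a) := by
  have hlow : Filter.Tendsto (fun x => a - e x) l (𝓝 (a - 0)) :=
    ENNReal.Tendsto.sub tendsto_const_nhds he (Or.inr ENNReal.zero_ne_top)
  have hupp : Filter.Tendsto (fun x => a + e x) l (𝓝 (a + 0)) := tendsto_const_nhds.add he
  rw [tsub_zero] at hlow
  rw [add_zero] at hupp
  exact tendsto_of_tendsto_of_tendsto_of_le_of_le' hlow hupp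
    (h₂.mono fun x hx => tsub_le_iff_right.2 hx) h₁

/-- The rescaled bottleneck distances converge to the distance of the ray diagrams. -/
theorem exists_tendsto_bottleneckDist {R R' : ℝ × ℝ → ℝ × ℝ → ℕ} {S S' : Finset (ℝ × ℝ)}
    (hR : IsGradedRank R S) (hR' : IsGradedRank R' S') (x : ℝ)
    (c : ℝ → Set.Ioo (0 : ℝ) 1 → ℝ) (D E : ℝ → Set.Ioo (0 : ℝ) 1 → Multiset DgmPoint)
    (hD : ∀ y m, IsRankDiagram R (fun s => (x + m * (s - c y m), y + (s - c y m))) (D y m))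
    (hE : ∀ y m, IsRankDiagram R' (fun s => (x + m * (s - c y m), y + (s - c y m))) (E y m)) :
    ∃ ℓ : ℝ≥0∞,
      (∀ y, Filter.Tendsto (fun m : Set.Ioo (0 : ℝ) 1 =>
        ENNReal.ofReal m * bottleneckDist (D y m) (E y m)) zeroPlus (𝓝 ℓ)) ∧
      ((∀ y m, bottleneckDist (D y m) (E y m) ≠ ⊤) → ℓ ≠ ⊤) := by
  obtain ⟨Y, hY⟩ : ∃ Y, ∀ g ∈ S ∪ S', g.2 ≤ Y := by
    classical
    obtain ⟨Y, hY⟩ := ((S ∪ S').image Prod.snd).bddAbove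
    exact ⟨Y, fun g hg => hY (Finset.mem_coe.2 (Finset.mem_image_of_mem _ hg))⟩
  have key : ∀ {R : ℝ × ℝ → ℝ × ℝ → ℕ} {S : Finset (ℝ × ℝ)}, IsGradedRank R S →
      (∀ g ∈ S, g.2 ≤ Y) → ∀ D : ℝ → Set.Ioo (0 : ℝ) 1 → Multiset DgmPoint,
      (∀ y m, IsRankDiagram R (fun s => (x + m * (s - c y m), y + (s - c y m))) (D y m)) →
      ∃ D₀, IsProper D₀ ∧ ∀ y, ∃ K : ℝ, ∀ᶠ m : Set.Ioo (0 : ℝ) 1 in zeroPlus,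
        IsNear (ENNReal.ofReal (m * K)) ((D y m).map (rescale m (c y m))) D₀ := by
    intro R S hR hY D hD
    have hev : ∀ y, ∃ K : ℝ, ∀ᶠ m : Set.Ioo (0 : ℝ) 1 in zeroPlus, ∃ D', IsRayDiagram R x Y D' ∧
        IsNear (ENNReal.ofReal (m * K)) ((D y m).map (rescale m (c y m))) D' := by
      intro y
      obtain ⟨K, hK⟩ := hR.exists_isRayDiagram x y hY
      exact ⟨K, (Filter.tendsto_comap.eventually hK).mono fun m hm => hm _ _ (hD y m)⟩
    obtain ⟨K, hK⟩ := hev 0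
    obtain ⟨m, D₀, hD₀, -⟩ := hK.exists
    refine ⟨D₀, hD₀.proper, fun y => ?_⟩
    obtain ⟨K, hK⟩ := hev y
    refine ⟨K, hK.mono fun m hm => ?_⟩
    obtain ⟨D', hD', hnear⟩ := hm
    rwa [hD'.unique hD₀] at hnear
  obtain ⟨D₀, hD₀, hDnear⟩ := key hR (fun g hg => hY g (Finset.mem_union_left _ hg)) D hD
  obtain ⟨E₀, hE₀, hEnear⟩ := key hR' (fun g hg => hY g (Finset.mem_union_right _ hg)) E hE
  have hbound : ∀ y, ∃ e : Set.Ioo (0 : ℝ) 1 → ℝ≥0∞, Filter.Tendsto e zeroPlus (𝓝 0) ∧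
      (∀ m, e m ≠ ⊤) ∧ ∀ᶠ m : Set.Ioo (0 : ℝ) 1 in zeroPlus,
        ENNReal.ofReal m * bottleneckDist (D y m) (E y m) ≤ bottleneckDist D₀ E₀ + e m ∧
        bottleneckDist D₀ E₀ ≤ ENNReal.ofReal m * bottleneckDist (D y m) (E y m) + e m := by
    intro y
    obtain ⟨K, hK⟩ := hDnear y
    obtain ⟨K', hK'⟩ := hEnear y
    refine ⟨fun m => ENNReal.ofReal (m * K) + ENNReal.ofReal (m * K'), ?_, fun m => by simp, ?_⟩
    · simpa using (tendsto_ofReal_mul_zeroPlus K).add (tendsto_ofReal_mul_zeroPlus K')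
    · filter_upwards [hK, hK'] with m hm hm'
      have hmpos : (0 : ℝ) < m := m.2.1
      rw [← bottleneckDist_rescale hmpos (c y m) (hD y m).proper (hE y m).proper]
      have hDr := (hD y m).proper.rescale hmpos (c y m)
      have hEr := (hE y m).proper.rescale hmpos (c y m)
      constructor
      · refine (bottleneckDist_triangle hDr hD₀ hEr).trans
          ((add_le_add hm.bottleneckDist_le ((bottleneckDist_triangle hD₀ hE₀ hEr).trans
            (add_le_add_right hm'.symm.bottleneckDist_le _))).trans_eq ?_)
        ring
      · refine (bottleneckDist_triangle hD₀ hDr hE₀).trans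
          ((add_le_add hm.symm.bottleneckDist_le ((bottleneckDist_triangle hDr hEr hE₀).trans
            (add_le_add_right hm'.bottleneckDist_le _))).trans_eq ?_)
        ring
  refine ⟨bottleneckDist D₀ E₀, fun y => ?_, fun hfin => ?_⟩
  · obtain ⟨e, he, -, hle⟩ := hbound y
    exact ENNReal.tendsto_of_le_add he (hle.mono fun _ h => h.1) (hle.mono fun _ h => h.2)
  · obtain ⟨e, -, he, hle⟩ := hbound 0
    obtain ⟨m, hm⟩ := hle.exists
    exact ne_top_of_le_ne_top (ENNReal.add_ne_top.2
      ⟨ENNReal.mul_ne_top ENNReal.ofReal_ne_top (hfin 0 m), he m⟩) hm.2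

/-! ### Finiteness of the distance does not depend on the line -/

theorem exists_aliveCount_eq_topCount (D : Multiset DgmPoint) (a : ℝ) :
    ∃ s, a ≤ s ∧ aliveCount D s s = topCount D := by
  classical
  have h : ∃ s, a ≤ s ∧ ∀ p ∈ D, p.1 ≤ s ∧ ((s : WithTop ℝ) < p.2 → p.2 = ⊤) := by
    induction D using Multiset.induction_on with
    | empty => exact ⟨a, le_rfl, by simp⟩
    | cons p D ih =>
      obtain ⟨s, has, hs⟩ := ih
      obtain ⟨x, hx⟩ : ∃ x : ℝ, (x : WithTop ℝ) < p.2 → p.2 = ⊤ := by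
        rcases p with ⟨b, _ | d⟩
        · exact ⟨0, fun _ => rfl⟩
        · exact ⟨d, fun h => absurd h (lt_irrefl _)⟩
      refine ⟨max s (max p.1 x), has.trans (le_max_left _ _), fun q hq => ?_⟩
      rw [WithTop.coe_max, WithTop.coe_max]
      rcases Multiset.mem_cons.1 hq with rfl | hq
      · exact ⟨(le_max_left _ _).trans (le_max_right _ _), fun h =>
          hx (((le_max_right _ _).trans (le_max_right _ _)).trans_lt h)⟩
      · exact ⟨(hs q hq).1.trans (le_max_left _ _), fun h =>
          (hs q hq).2 ((le_max_left _ _).trans_lt h)⟩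
  obtain ⟨s, has, hs⟩ := h
  refine ⟨s, has, ?_⟩
  rw [aliveCount, topCount, Multiset.countP_eq_card_filter]
  congr 1
  refine Multiset.filter_congr fun p hp => ⟨fun h => (hs p hp).2 h.2, fun h => ⟨(hs p hp).1, ?_⟩⟩
  rw [h]
  exact WithTop.coe_lt_top s

theorem PersistenceModule.IsFinitelyPresented.topCount_dgm_eq {F : Type u} [Field F]
    {M : PersistenceModule.{u, v} F (ℝ × ℝ)} (hM : M.IsFinitelyPresented) (L L' : PosLine) :
    topCount (dgm (M.restrict L)) = topCount (dgm (M.restrict L')) := by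
  obtain ⟨S, hS⟩ := hM.exists_isGradedRank
  obtain ⟨q, hq⟩ := S.bddAbove
  have h : ∀ L : PosLine, topCount (dgm (M.restrict L)) = M.rank q q := by
    intro L
    obtain ⟨s, hs, hcount⟩ := exists_aliveCount_eq_topCount (dgm (M.restrict L)) (L.push q)
    rw [← hcount, (hM.isRankDiagram L).aliveCount_eq le_rfl]
    have hge : ∀ g ∈ S, g ≤ L.point s ↔ g ≤ q := fun g hg =>
      iff_of_true ((hq hg).trans ((L.push_le_iff q s).1 hs)) (hq hg)
    exact hS.congr le_rfl le_rfl hge hge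
  rw [h L, h L']

theorem bottleneckDist_dgm_ne_top {F : Type u} [Field F]
    {M : PersistenceModule.{u, v} F (ℝ × ℝ)} {N : PersistenceModule.{u, w} F (ℝ × ℝ)}
    (hM : M.IsFinitelyPresented) (hN : N.IsFinitelyPresented)
    (h : ∃ L : PosLine, weightedDist M N L ≠ ⊤) (L : PosLine) :
    bottleneckDist (dgm (M.restrict L)) (dgm (N.restrict L)) ≠ ⊤ := by
  obtain ⟨L', hL'⟩ := h
  have hw : 0 < L'.weight := lt_min L'.m_fst_pos L'.m_snd_pos
  refine bottleneckDist_ne_top_of_topCount_eq ?_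
  rw [hM.topCount_dgm_eq L L', hN.topCount_dgm_eq L L']
  refine topCount_eq_of_bottleneckDist_ne_top fun htop => hL' ?_
  rw [weightedDist, htop, ENNReal.mul_top (ENNReal.ofReal_pos.2 hw).ne']

/-! ### Steep and shallow lines -/

theorem PosLine.steep_point (r : ℝ × ℝ) (m : Set.Ioo (0 : ℝ) 1) (s : ℝ) :
    (PosLine.steep r m).point s =
      (r.1 + m * (s - (r.1 + r.2) / (m + 1)), r.2 + (s - (r.1 + r.2) / (m + 1))) := by
  ext <;> simp [steep, through, point] <;> ring

theorem PosLine.shallow_point (r : ℝ × ℝ) (m : Set.Ioo (0 : ℝ) 1) (s : ℝ) :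
    (PosLine.shallow r m).point s =
      (r.1 + (s - (r.1 + r.2) / (1 + m)), r.2 + m * (s - (r.1 + r.2) / (1 + m))) := by
  ext <;> simp [shallow, through, point] <;> ring

theorem PosLine.steep_weight (r : ℝ × ℝ) (m : Set.Ioo (0 : ℝ) 1) :
    (PosLine.steep r m).weight = m := min_eq_left m.2.2.le

theorem PosLine.shallow_weight (r : ℝ × ℝ) (m : Set.Ioo (0 : ℝ) 1) :
    (PosLine.shallow r m).weight = m := min_eq_right m.2.2.le

theorem theorem3p8 {F : Type u} [Field F]
    (M : PersistenceModule.{u, v} F (ℝ × ℝ)) (N : PersistenceModule.{u, w} F (ℝ × ℝ))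
    (hM : M.IsFinitelyPresented) (hN : N.IsFinitelyPresented) :
    (∀ x : ℝ, ∃ ℓ : ℝ≥0∞,
      (∀ r ∈ verticalLine x,
        Filter.Tendsto (fun m₁ => weightedDist M N (PosLine.steep r m₁)) zeroPlus (𝓝 ℓ)) ∧
      ((∃ L : PosLine, weightedDist M N L ≠ ⊤) → ℓ ≠ ⊤)) ∧
    (∀ y : ℝ, ∃ ℓ : ℝ≥0∞,
      (∀ r ∈ horizontalLine y,
        Filter.Tendsto (fun m₂ => weightedDist M N (PosLine.shallow r m₂)) zeroPlus (𝓝 ℓ)) ∧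
      ((∃ L : PosLine, weightedDist M N L ≠ ⊤) → ℓ ≠ ⊤)) := by
  obtain ⟨S, hS⟩ := hM.exists_isGradedRank
  obtain ⟨T, hT⟩ := hN.exists_isGradedRank
  constructor
  · intro x
    have hdgm : ∀ {R : ℝ × ℝ → ℝ × ℝ → ℕ} {D : PosLine → Multiset DgmPoint},
        (∀ L, IsRankDiagram R L.point (D L)) → ∀ (y : ℝ) (m : Set.Ioo (0 : ℝ) 1),
        IsRankDiagram R (fun s => (x + m * (s - (x + y) / (m + 1)), y + (s - (x + y) / (m + 1))))
          (D (PosLine.steep (x, y) m)) := by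
      intro R D hD y m
      have h := hD (PosLine.steep (x, y) m)
      rwa [funext (PosLine.steep_point (x, y) m)] at h
    obtain ⟨ℓ, hlim, hfin⟩ := exists_tendsto_bottleneckDist hS hT x (fun y m => (x + y) / (m + 1))
      _ _ (hdgm fun L => hM.isRankDiagram L) (hdgm fun L => hN.isRankDiagram L)
    refine ⟨ℓ, ?_, fun h => hfin fun y m => bottleneckDist_dgm_ne_top hM hN h _⟩
    rintro ⟨_, y⟩ rfl
    simpa only [weightedDist, PosLine.steep_weight] using hlim y
  -- reflection in the diagonal turns shallow lines into steep ones
  · intro y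
    have hdgm : ∀ {R : ℝ × ℝ → ℝ × ℝ → ℕ} {D : PosLine → Multiset DgmPoint},
        (∀ L, IsRankDiagram R L.point (D L)) → ∀ (x : ℝ) (m : Set.Ioo (0 : ℝ) 1),
        IsRankDiagram (fun p q => R p.swap q.swap)
          (fun s => (y + m * (s - (x + y) / (1 + m)), x + (s - (x + y) / (1 + m))))
          (D (PosLine.shallow (x, y) m)) := by
      intro R D hD x m
      have h := hD (PosLine.shallow (x, y) m)
      rw [funext (PosLine.shallow_point (x, y) m)] at h
      exact ⟨h.proper, h.aliveCount_eq⟩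
    obtain ⟨ℓ, hlim, hfin⟩ := exists_tendsto_bottleneckDist hS.swap hT.swap y
      (fun x m => (x + y) / (1 + m)) _ _ (hdgm fun L => hM.isRankDiagram L)
      (hdgm fun L => hN.isRankDiagram L)
    refine ⟨ℓ, ?_, fun h => hfin fun x m => bottleneckDist_dgm_ne_top hM hN h _⟩
    rintro ⟨x, _⟩ rfl
    simpa only [weightedDist, PosLine.shallow_weight] using hlim x
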